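/- Let $P=ax^4+bx^2+cx+d\in\mathbb{Q}[x]$ be an irreducible quartic with Galois group $S_4$ and four real roots $x_1>x_2>x_3>x_4$. Put $\mathbb{D}=\prod_{j<k}(x_j-x_k)$ and suppose that $\Delta=\mathbb{D}^2$ (a rational number) is an integer. Let $L=\mathbb{Q}(x_1,x_2,x_3,x_4,i)\subset\mathbb{C}$, $G=\mathrm{Gal}(L/\mathbb{Q})$ and $F=\mathbb{Q}(x_1,i\mathbb{D})$, a field of degree $8$ over $\mathbb{Q}$. For $j=1,\dots,4$ let $\varphi_j:F\to L$ be the embedding with $\varphi_j(x_1)=x_j$ and $\varphi_j(i\mathbb{D})=(-1)^{j+1}i\mathbb{D}$; the embeddings of $F$ are the $\varphi_j$ and their complex conjugates $\varphi_{\bar j}$. Let $V=\mathbb{R}\otimes_{\mathbb{Q}}F$ and $\Lambda=\mathfrak{o}_F\subset V$. For an embedding $\iota$ of $F$ let $dz_\iota$ be the translation-invariant one-form on $V/\Lambda$ induced by $\iota$; write $dz_j=dz_{\varphi_j}$, so that $dz_{\varphi_{\bar j}}=d\bar z_j$. Let $X$ be the complex torus $V/\Lambda$ with holomorphic coordinates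 $z_1,\dots,z_4$, and identify $H^\bullet(X,\mathbb{C})$ with the algebra of translation-invariant forms. The class $$M=\mathbb{D}\,(dz_1\,d\bar z_2\,dz_3\,d\bar z_4+d\bar z_1\,dz_2\,d\bar z_3\,dz_4)$$ is a rational class of type $(2,2)$ that does not lie in the $\mathbb{Q}$-span of the products of two rational $(1,1)$ classes. For $a\in L$ fixed by the stabiliser (of order $4$) of the set $\{\varphi_1,\varphi_3\}$ in $G$, let $$A(a)=\tfrac14\sum_{g\in G} g\bigl(a(x_1-x_3)\bigr)\,dz_{g\varphi_1}\wedge dz_{g\varphi_3}=a(x_1-x_3)\,dz_1\wedge dz_3+\cdots,$$ with one term for each of the $12$ unordered pairs in the $G$-orbit of $\{\varphi_1,\varphi_3\}$. Let $h_3=x_1x_3+x_2x_4$, let $c$ be an integer, and put $A_1=A(h_3)$ and $A_2=A(ic\mathbb{D}h_3)$. Suppose that $A_1$ and $A_2$ are integral classes, let $L_1,L_2$ be smooth complex line bundles on $X$ with $c_1(L_i)=A_i$, and let $\mathcal{V}_i=L_i\oplus L_i^{-1}$. Then $$ch(\mathcal{V}_1^{c^2\Delta}\ominus\mathcal{V}_2)=4c^2\Delta\,M+r_0+r_8$$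 for some $r_0\in H^0(X,\mathbb{Q})$ and $r_8\in H^8(X,\mathbb{Q})$. -/

import Mathlib

open scoped ContDiff Matrix

noncomputable section

/-! ### Real tori `V ⧸ Λ`: forms, smooth complex vector bundles, connections, Chern classes -/

namespace Torus

/-- Complex-valued real-linear functionals on `V`. They are the translation-invariant complex
one-forms on `V ⧸ Λ`, that is, `H¹(V ⧸ Λ, ℂ)` when `Λ` is a lattice. -/
abbrev Covector (V : Type) [AddCommGroup V] [Module ℝ V] : Type := V →ₗ[ℝ] ℂ

/-- The translation-invariant complex forms of all degrees on `V ⧸ Λ`, that is,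
`H^•(V ⧸ Λ, ℂ)` when `Λ` is a lattice; the product is the wedge product. -/
abbrev InvForm (V : Type) [AddCommGroup V] [Module ℝ V] : Type := ExteriorAlgebra ℂ (Covector V)

/-- The inclusion of one-forms. -/
abbrev oneForm {V : Type} [AddCommGroup V] [Module ℝ V] : Covector V →ₗ[ℂ] InvForm V :=
  ExteriorAlgebra.ι ℂ

/-- The exterior algebra of a finite-dimensional space is finite-dimensional. -/
theorem exteriorAlgebra_finite (W : Type) [AddCommGroup W] [Module ℂ W] [Module.Finite ℂ W] :
    Module.Finite ℂ (ExteriorAlgebra ℂ W) := by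
  have htop : (⨆ k, ⋀[ℂ]^k W) = ⊤ :=
    (DirectSum.Decomposition.isInternal (fun k => ⋀[ℂ]^k W)).submodule_iSup_eq_top
  have hbot : ∀ k, Module.finrank ℂ W < k → (⋀[ℂ]^k W) = ⊥ := by
    intro k hk
    have h0 : Module.finrank ℂ (⋀[ℂ]^k W) = 0 := by
      rw [exteriorPower.finrank_eq, Nat.choose_eq_zero_of_lt hk]
    exact Submodule.finrank_eq_zero.mp h0
  have hle : (⊤ : Submodule ℂ (ExteriorAlgebra ℂ W)) =
      ⨆ k ∈ Finset.range (Module.finrank ℂ W + 1), ⋀[ℂ]^k W := by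
    rw [← htop]
    apply le_antisymm
    · refine iSup_le fun k => ?_
      by_cases hk : k < Module.finrank ℂ W + 1
      · exact le_iSup₂_of_le k (Finset.mem_range.mpr hk) le_rfl
      · rw [hbot k (by omega)]
        exact bot_le
    · exact iSup₂_le fun k _ => le_iSup (fun k => ⋀[ℂ]^k W) k
  refine ⟨?_⟩
  rw [hle]
  exact Submodule.fg_biSup _ _ fun k _ => Module.Finite.iff_fg.mp inferInstance

section General

variable {V : Type} [NormedAddCommGroup V] [NormedSpace ℝ V] [FiniteDimensional ℝ V]

instance invForm_finite : Module.Finite ℂ (InvForm V) := exteriorAlgebra_finite (Covector V)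

/-- Differential forms (of mixed degree, with complex coefficients, not necessarily smooth) on
`V ⧸ Λ`. The cotangent bundle of the torus is trivialised by translations. -/
abbrev Form (Λ : AddSubgroup V) : Type := (V ⧸ Λ) → InvForm V

/-- Smoothness of a function on the subset `U` of `V ⧸ Λ`, tested on `V`. -/
def SmoothOn {Λ : AddSubgroup V} (f : V ⧸ Λ → ℂ) (U : Set (V ⧸ Λ)) : Prop :=
  ContDiffOn ℝ ∞ (fun v : V => f (QuotientAddGroup.mk v)) (QuotientAddGroup.mk ⁻¹' U)

/-- A form is smooth if its coefficients are. -/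
def Form.Smooth {Λ : AddSubgroup V} (η : Form Λ) : Prop :=
  ∀ l : InvForm V →ₗ[ℂ] ℂ, SmoothOn (fun x => l (η x)) Set.univ

/-- The derivative of `f` at `x` in the direction of the tangent vector `w`. -/
def dirDeriv {Λ : AddSubgroup V} (w : V) (f : V ⧸ Λ → ℂ) (x : V ⧸ Λ) : ℂ :=
  deriv (fun t : ℝ => f (x + QuotientAddGroup.mk (t • w))) 0

/-- The coefficientwise derivative of a form in the direction of `w`, for the trivialisation by
translations. (It does not depend on the basis used to take coefficients.) -/
def Form.dirDeriv {Λ : AddSubgroup V} (w : V) (η : Form Λ) : Form Λ := fun x =>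
  ∑ k, Torus.dirDeriv w (fun y => (Module.finBasis ℂ (InvForm V)).repr (η y) k) x •
    Module.finBasis ℂ (InvForm V) k

/-- A real functional, regarded as a complex-valued one. -/
def complexify (ξ : V →ₗ[ℝ] ℝ) : Covector V := Complex.ofRealCLM.toLinearMap.comp ξ

/-- The exterior derivative `d η = ∑ᵢ dtᵢ ∧ ∂η/∂tᵢ`, where the `tᵢ` are linear coordinates
on `V`. (It does not depend on the coordinates.) -/
def Form.extDeriv {Λ : AddSubgroup V} (η : Form Λ) : Form Λ := fun x =>
  ∑ i, oneForm (complexify ((Module.finBasis ℝ V).coord i)) *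
    Form.dirDeriv (Module.finBasis ℝ V i) η x

/-- A smooth complex vector bundle on the torus `V ⧸ Λ` whose rank is the number of elements
of `n`, presented by an open cover and smooth transition functions: on `U i` it has a frame, and
the coordinates of a section in the frames over `U i` and `U j` satisfy `sᵢ = gᵢⱼ sⱼ`. -/
structure SmoothBundle (Λ : AddSubgroup V) (n : Type) [Fintype n] [DecidableEq n] where
  I : Type
  U : I → Set (V ⧸ Λ)
  isOpen_U : ∀ i, IsOpen (U i)
  cover : ∀ x, ∃ i, x ∈ U i
  g : I → I → V ⧸ Λ → Matrix n n ℂ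
  smooth_g : ∀ i j a b, SmoothOn (fun x => g i j x a b) (U i ∩ U j)
  g_self : ∀ i, ∀ x ∈ U i, g i i x = 1
  g_comp : ∀ i j k, ∀ x ∈ U i ∩ U j ∩ U k, g i j x * g j k x = g i k x

/-- Smooth complex line bundles. -/
abbrev LineBundle (Λ : AddSubgroup V) : Type 1 := SmoothBundle Λ Unit

namespace SmoothBundle

variable {Λ : AddSubgroup V} {n m : Type} [Fintype n] [DecidableEq n] [Fintype m] [DecidableEq m]

/-- The dual bundle; for a line bundle `L` this is `L⁻¹`. -/
def dual (E : SmoothBundle Λ n) : SmoothBundle Λ n where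
  I := E.I
  U := E.U
  isOpen_U := E.isOpen_U
  cover := E.cover
  g i j x := (E.g j i x)ᵀ
  smooth_g i j a b := by
    have h := E.smooth_g j i b a
    rw [Set.inter_comm] at h
    exact h
  g_self i x hx := by rw [E.g_self i x hx, Matrix.transpose_one]
  g_comp i j k x hx := by
    rw [← Matrix.transpose_mul, E.g_comp k j i x ⟨⟨hx.2, hx.1.2⟩, hx.1.1⟩]

/-- The direct sum of two bundles. -/
def directSum (E : SmoothBundle Λ n) (E' : SmoothBundle Λ m) : SmoothBundle Λ (n ⊕ m) where
  I := E.I × E'.I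
  U p := E.U p.1 ∩ E'.U p.2
  isOpen_U p := (E.isOpen_U p.1).inter (E'.isOpen_U p.2)
  cover x := by
    obtain ⟨i, hi⟩ := E.cover x
    obtain ⟨j, hj⟩ := E'.cover x
    exact ⟨(i, j), hi, hj⟩
  g p q x := Matrix.fromBlocks (E.g p.1 q.1 x) 0 0 (E'.g p.2 q.2 x)
  smooth_g p q a b := by
    rcases a with a | a <;> rcases b with b | b
    · refine (E.smooth_g p.1 q.1 a b).mono ?_
      rintro v ⟨h, h'⟩
      exact ⟨h.1, h'.1⟩
    · exact contDiffOn_const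
    · exact contDiffOn_const
    · refine (E'.smooth_g p.2 q.2 a b).mono ?_
      rintro v ⟨h, h'⟩
      exact ⟨h.2, h'.2⟩
  g_self p x hx := by
    rw [E.g_self p.1 x hx.1, E'.g_self p.2 x hx.2, Matrix.fromBlocks_one]
  g_comp p q r x hx := by
    rw [Matrix.fromBlocks_multiply, ← E.g_comp p.1 q.1 r.1 x ⟨⟨hx.1.1.1, hx.1.2.1⟩, hx.2.1⟩,
      ← E'.g_comp p.2 q.2 r.2 x ⟨⟨hx.1.1.2, hx.1.2.2⟩, hx.2.2⟩]
    simp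

/-- The direct sum of `N` copies of a bundle. -/
def copies (N : ℕ) (E : SmoothBundle Λ n) : SmoothBundle Λ (n × Fin N) where
  I := E.I
  U := E.U
  isOpen_U := E.isOpen_U
  cover := E.cover
  g i j x := Matrix.blockDiagonal fun _ : Fin N => E.g i j x
  smooth_g i j a b := by
    by_cases h : a.2 = b.2
    · simpa [Matrix.blockDiagonal_apply, h] using E.smooth_g i j a.1 b.1
    · simp only [Matrix.blockDiagonal_apply, h, if_false]
      exact contDiffOn_const
  g_self i x hx := by
    rw [E.g_self i x hx]
    exact Matrix.blockDiagonal_one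
  g_comp i j k x hx := by
    rw [← Matrix.blockDiagonal_mul]
    exact congrArg Matrix.blockDiagonal (funext fun _ => E.g_comp i j k x hx)

/-- A smooth connection on `E`: in the frame over `U i` it is `s ↦ ds + θᵢ s`, with `θᵢ` a matrix
of smooth one-forms on `U i`, and `gᵢⱼ θⱼ = d gᵢⱼ + θᵢ gᵢⱼ` on overlaps. -/
structure Connection (E : SmoothBundle Λ n) where
  θ : E.I → V ⧸ Λ → Matrix n n (Covector V)
  smooth_θ : ∀ i a b (w : V), SmoothOn (fun x => θ i x a b w) (E.U i)
  compat : ∀ i j, ∀ x ∈ E.U i ∩ E.U j, ∀ w : V,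
    E.g i j x * (θ j x).map (fun ξ => ξ w) =
      Matrix.of (fun a b => dirDeriv w (fun y => E.g i j y a b) x) +
        (θ i x).map (fun ξ => ξ w) * E.g i j x

/-- The connection matrix in the frame over `U i`, as a matrix of differential forms. -/
def Connection.form {E : SmoothBundle Λ n} (D : E.Connection) (i : E.I) : Matrix n n (Form Λ) :=
  Matrix.of fun a b x => oneForm (D.θ i x a b)

/-- The curvature matrix `dθ + θ ∧ θ` in the frame over `U i` (meaningful on `U i`). -/
def Connection.curvature {E : SmoothBundle Λ n} (D : E.Connection) (i : E.I) :
    Matrix n n (Form Λ) :=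
  (D.form i).map Form.extDeriv + D.form i * D.form i

/-- `(√-1 / 2π)` times the curvature matrix. -/
def Connection.normCurvature {E : SmoothBundle Λ n} (D : E.Connection) (i : E.I) :
    Matrix n n (Form Λ) :=
  (Complex.I / (2 * Real.pi) : ℂ) • D.curvature i

/-- The first Chern form of a connection, on `U i`. -/
def Connection.firstChernForm {E : SmoothBundle Λ n} (D : E.Connection) (i : E.I) : Form Λ :=
  (D.normCurvature i).trace

/-- The Chern character form `tr exp (√-1 F / 2π)` of a connection, on `U i`. The exponential
series is finite, since the `k`-th power of the curvature has degree `2k`. -/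
def Connection.chernCharacterForm {E : SmoothBundle Λ n} (D : E.Connection) (i : E.I) : Form Λ :=
  ∑ k ∈ Finset.range (Module.finrank ℝ V + 1),
    ((k.factorial : ℂ)⁻¹) • ((D.normCurvature i) ^ k).trace

/-- `c₁(E) = α` in `H²(V ⧸ Λ, ℂ)`, by Chern–Weil theory: the first Chern form of a connection
on `E` (the choice of which does not affect its cohomology class) is a closed form that differs
from the invariant form `α` by an exact form. -/
def HasFirstChernClass (E : SmoothBundle Λ n) (α : InvForm V) : Prop :=
  ∃ (D : E.Connection) (β : Form Λ), Form.Smooth β ∧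
    ∀ i, ∀ x ∈ E.U i, D.firstChernForm i x = α + Form.extDeriv β x

/-- `ch(E) = η` in `H^•(V ⧸ Λ, ℂ)`, by Chern–Weil theory: the Chern character form of a
connection on `E` (the choice of which does not affect its cohomology class) differs from the
invariant form `η` by an exact form. -/
def HasChernCharacter (E : SmoothBundle Λ n) (η : InvForm V) : Prop :=
  ∃ (D : E.Connection) (β : Form Λ), Form.Smooth β ∧
    ∀ i, ∀ x ∈ E.U i, D.chernCharacterForm i x = η + Form.extDeriv β x

/-- `ch(E ⊖ E') = η` for the virtual bundle `E ⊖ E'`, where `ch(E ⊖ E') = ch(E) - ch(E')`. -/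
def HasVirtualChernCharacter (E : SmoothBundle Λ n) (E' : SmoothBundle Λ m) (η : InvForm V) :
    Prop :=
  ∃ η₁ η₂, E.HasChernCharacter η₁ ∧ E'.HasChernCharacter η₂ ∧ η = η₁ - η₂

end SmoothBundle

/-- `H^k(V ⧸ Λ, ℤ)`: the `k`-th exterior power of `H¹(V ⧸ Λ, ℤ) = Hom(Λ, ℤ)`, inside the
invariant forms. -/
def integralClasses (Λ : AddSubgroup V) (k : ℕ) : Submodule ℤ (InvForm V) :=
  Submodule.span ℤ (oneForm '' {ξ : Covector V | ∀ v ∈ Λ, ∃ m : ℤ, ξ v = m}) ^ k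

/-- `H^k(V ⧸ Λ, ℚ)`: the `k`-th exterior power of `H¹(V ⧸ Λ, ℚ) = Hom(Λ, ℚ)`, inside the
invariant forms. -/
def rationalClasses (Λ : AddSubgroup V) (k : ℕ) : Submodule ℚ (InvForm V) :=
  Submodule.span ℚ (oneForm '' {ξ : Covector V | ∀ v ∈ Λ, ∃ q : ℚ, ξ v = q}) ^ k

end General

end Torus

/-! ### The abelian four-folds -/

/-- A quartic `a X⁴ + b X² + c X + d` over `ℚ`, irreducible, with Galois group the symmetric
group on four letters and four real roots `x 0 > x 1 > x 2 > x 3`. -/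
structure MumfordQuartic where
  a : ℚ
  b : ℚ
  c : ℚ
  d : ℚ
  irreducible : Irreducible (Polynomial.C a * Polynomial.X ^ 4 + Polynomial.C b * Polynomial.X ^ 2 +
    Polynomial.C c * Polynomial.X + Polynomial.C d)
  x : Fin 4 → ℝ
  strictAnti : StrictAnti x
  root : ∀ j, (a : ℝ) * x j ^ 4 + b * x j ^ 2 + c * x j + d = 0
  gal : Nonempty ((Polynomial.C a * Polynomial.X ^ 4 + Polynomial.C b * Polynomial.X ^ 2 +
    Polynomial.C c * Polynomial.X + Polynomial.C d).Gal ≃* Equiv.Perm (Fin 4))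

namespace MumfordQuartic

variable (Q : MumfordQuartic)

/-- The polynomial. -/
def poly : Polynomial ℚ :=
  Polynomial.C Q.a * Polynomial.X ^ 4 + Polynomial.C Q.b * Polynomial.X ^ 2 +
    Polynomial.C Q.c * Polynomial.X + Polynomial.C Q.d

/-- The square root `𝔻` of the discriminant (up to scaling by the leading coefficient). -/
def disc : ℝ :=
  (Q.x 0 - Q.x 1) * (Q.x 0 - Q.x 2) * (Q.x 0 - Q.x 3) * (Q.x 1 - Q.x 2) * (Q.x 1 - Q.x 3) *
    (Q.x 2 - Q.x 3)

/-- The field `L = ℚ(x₁, x₂, x₃, x₄, i)`. -/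
def L : IntermediateField ℚ ℂ :=
  IntermediateField.adjoin ℚ (Set.range (fun j => (Q.x j : ℂ)) ∪ {Complex.I})

/-- The root `x j`, as an element of `L`. -/
def rootL (j : Fin 4) : Q.L :=
  ⟨Q.x j, IntermediateField.subset_adjoin ℚ _ (Or.inl ⟨j, rfl⟩)⟩

/-- `√-1`, as an element of `L`. -/
def imL : Q.L := ⟨Complex.I, IntermediateField.subset_adjoin ℚ _ (Or.inr rfl)⟩

/-- `𝔻`, as an element of `L`. -/
def discL : Q.L :=
  (Q.rootL 0 - Q.rootL 1) * (Q.rootL 0 - Q.rootL 2) * (Q.rootL 0 - Q.rootL 3) *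
    (Q.rootL 1 - Q.rootL 2) * (Q.rootL 1 - Q.rootL 3) * (Q.rootL 2 - Q.rootL 3)

/-- The Galois group of `L` over `ℚ`. -/
abbrev G : Type := Q.L ≃ₐ[ℚ] Q.L

/-- The field `F = ℚ(x₁, i𝔻)`, a CM field of degree eight. -/
def F : IntermediateField ℚ Q.L := IntermediateField.adjoin ℚ {Q.rootL 0, Q.imL * Q.discL}

/-- `x₁`, as an element of `F`. -/
def rootF : Q.F := ⟨Q.rootL 0, IntermediateField.subset_adjoin ℚ _ (Or.inl rfl)⟩

/-- `i𝔻`, as an element of `F`. -/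
def imDiscF : Q.F := ⟨Q.imL * Q.discL, IntermediateField.subset_adjoin ℚ _ (Or.inr rfl)⟩

theorem poly_ne_zero : Q.poly ≠ 0 := Q.irreducible.ne_zero

theorem aeval_poly (j : Fin 4) : Polynomial.aeval (Q.x j : ℂ) Q.poly = 0 := by
  have h := congrArg (fun r : ℝ => (r : ℂ)) (Q.root j)
  simp only [Complex.ofReal_add, Complex.ofReal_mul, Complex.ofReal_pow, Complex.ofReal_zero,
    Complex.ofReal_ratCast] at h
  simpa [poly] using h

instance finiteDimensional_L : FiniteDimensional ℚ Q.L := by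
  have : Finite (Set.range (fun j => (Q.x j : ℂ)) ∪ {Complex.I} : Set ℂ) := by
    apply Set.Finite.to_subtype
    exact (Set.finite_range _).union (Set.finite_singleton _)
  apply IntermediateField.finiteDimensional_adjoin
  rintro z (⟨j, rfl⟩ | rfl)
  · exact IsAlgebraic.isIntegral ⟨Q.poly, Q.poly_ne_zero, Q.aeval_poly j⟩
  · exact Complex.isIntegral_rat_I

theorem rootL_injective : Function.Injective Q.rootL := fun _ _ h =>
  Q.strictAnti.injective (Complex.ofReal_injective (congrArg Subtype.val h))

theorem aeval_rootL (j : Fin 4) : Polynomial.aeval (Q.rootL j) Q.poly = 0 := by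
  apply Subtype.val_injective
  have h := Polynomial.aeval_algebraMap_apply ℂ (Q.rootL j) Q.poly
  exact h.symm.trans (Q.aeval_poly j)

theorem natDegree_poly_le : Q.poly.natDegree ≤ 4 := by
  unfold poly
  compute_degree

theorem splits_poly : (Q.poly.map (algebraMap ℚ Q.L)).Splits := by
  have hne := Q.poly_ne_zero
  have hsub : (Finset.univ.image Q.rootL).val ≤ (Q.poly.map (algebraMap ℚ Q.L)).roots := by
    rw [Multiset.le_iff_subset (Finset.nodup _)]
    intro z hz
    obtain ⟨j, -, rfl⟩ := Finset.mem_image.mp (Finset.mem_def.mpr hz)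
    exact (Polynomial.mem_aroots.mpr ⟨hne, Q.aeval_rootL j⟩)
  have hcard := Multiset.card_le_card hsub
  rw [Finset.card_val, Finset.card_image_of_injective _ Q.rootL_injective, Finset.card_univ,
    Fintype.card_fin] at hcard
  rw [Polynomial.splits_iff_card_roots]
  apply le_antisymm (Polynomial.card_roots' _)
  rw [Polynomial.natDegree_map]
  exact Q.natDegree_poly_le.trans hcard

theorem mem_rootSet_iff (z : Q.L) : z ∈ Q.poly.rootSet Q.L ↔ ∃ j, z = Q.rootL j := by
  constructor
  · intro hz
    by_contra! hcon
    have hsub : insert z (Finset.univ.image Q.rootL) ⊆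
        (Q.poly.map (algebraMap ℚ Q.L)).roots.toFinset := by
      intro w hw
      rw [Multiset.mem_toFinset]
      rcases Finset.mem_insert.mp hw with rfl | hw
      · exact Polynomial.mem_aroots.mpr (Polynomial.mem_rootSet.mp hz)
      · obtain ⟨j, -, rfl⟩ := Finset.mem_image.mp hw
        exact Polynomial.mem_aroots.mpr ⟨Q.poly_ne_zero, Q.aeval_rootL j⟩
    have h1 := Finset.card_le_card hsub
    rw [Finset.card_insert_of_notMem, Finset.card_image_of_injective _ Q.rootL_injective,
      Finset.card_univ, Fintype.card_fin] at h1
    · have h2 := (Multiset.toFinset_card_le _).trans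
        (Polynomial.card_roots' (Q.poly.map (algebraMap ℚ Q.L)))
      rw [Polynomial.natDegree_map] at h2
      have := Q.natDegree_poly_le
      omega
    · intro hmem
      obtain ⟨j, -, rfl⟩ := Finset.mem_image.mp hmem
      exact hcon j rfl
  · rintro ⟨j, rfl⟩
    exact Polynomial.mem_rootSet.mpr ⟨Q.poly_ne_zero, Q.aeval_rootL j⟩

instance normal_L : Normal ℚ Q.L := by
  have hp0 : Q.poly * (Polynomial.X ^ 2 + 1) ≠ 0 :=
    mul_ne_zero Q.poly_ne_zero (Polynomial.Monic.ne_zero (by monicity!))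
  have hL : Q.L = IntermediateField.adjoin ℚ
      ((Q.poly * (Polynomial.X ^ 2 + 1)).rootSet ℂ) := by
    apply le_antisymm
    · apply IntermediateField.adjoin.mono
      rintro z (⟨j, rfl⟩ | rfl)
      · exact Polynomial.mem_rootSet.mpr ⟨hp0, by simp [Q.aeval_poly j]⟩
      · exact Polynomial.mem_rootSet.mpr ⟨hp0, by simp⟩
    · apply IntermediateField.adjoin_le_iff.mpr
      intro z hz
      have h := (Polynomial.mem_rootSet.mp hz).2
      rw [map_mul, mul_eq_zero] at h
      rcases h with h | h
      · have hs := Q.splits_poly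
        have hz' : z ∈ Q.poly.rootSet ℂ := Polynomial.mem_rootSet.mpr ⟨Q.poly_ne_zero, h⟩
        rw [← hs.image_rootSet Q.L.val] at hz'
        obtain ⟨w, -, rfl⟩ := hz'
        exact w.2
      · have h' : (z - Complex.I) * (z + Complex.I) = 0 := by
          have : z ^ 2 + 1 = 0 := by simpa using h
          linear_combination this - Complex.I_sq
        have hI : Complex.I ∈ Q.L := Q.imL.2
        rcases mul_eq_zero.mp h' with h' | h'
        · rw [sub_eq_zero.mp h']
          exact hI
        · rw [eq_neg_of_add_eq_zero_left h']
          exact neg_mem hI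
  rw [hL]
  exact Normal.of_isSplittingField (hFEp := IntermediateField.adjoin_rootSet_isSplittingField
    (IsAlgClosed.splits _)) _

/-- Every permutation of the roots is induced by an element of the Galois group of `L`. -/
theorem exists_perm (σ : Equiv.Perm (Fin 4)) : ∃ g : Q.G, ∀ k, g (Q.rootL k) = Q.rootL (σ k) := by
  have hfact : Fact ((Q.poly.map (algebraMap ℚ Q.L)).Splits) := ⟨Q.splits_poly⟩
  let e : Fin 4 ≃ Q.poly.rootSet Q.L := Equiv.ofBijective
    (fun j => ⟨Q.rootL j, (Q.mem_rootSet_iff _).mpr ⟨j, rfl⟩⟩)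
    ⟨fun j k h => Q.rootL_injective (congrArg Subtype.val h), fun z => by
      obtain ⟨j, hj⟩ := (Q.mem_rootSet_iff _).mp z.2
      exact ⟨j, Subtype.ext hj.symm⟩⟩
  obtain ⟨f⟩ := Q.gal
  have hbij : Function.Bijective (Polynomial.Gal.galActionHom Q.poly Q.L) := by
    have : Finite Q.poly.Gal := Finite.of_equiv _ f.symm.toEquiv
    refine Function.Injective.bijective_of_nat_card_le
      (Polynomial.Gal.galActionHom_injective Q.poly Q.L) (le_of_eq ?_)
    exact (Nat.card_congr (Equiv.permCongr e)).symm.trans (Nat.card_congr f.toEquiv).symm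
  obtain ⟨γ, hγ⟩ := hbij.2 (e.permCongr σ)
  obtain ⟨g, rfl⟩ := Polynomial.Gal.restrict_surjective Q.poly Q.L γ
  refine ⟨g, fun k => ?_⟩
  have h := Polynomial.Gal.galActionHom_restrict Q.poly Q.L g (e k)
  rw [hγ] at h
  rw [Equiv.permCongr_apply, Equiv.symm_apply_apply] at h
  exact h.symm

theorem imL_sq : Q.imL ^ 2 = -1 := Subtype.val_injective (by
  simp [imL])

theorem exists_conj : ∃ ρ : Q.G, (∀ k, ρ (Q.rootL k) = Q.rootL k) ∧ ρ Q.imL = -Q.imL := by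
  refine ⟨(Complex.conjAe.restrictScalars ℚ).restrictNormal Q.L, fun k => ?_, ?_⟩
  · apply (algebraMap Q.L ℂ).injective
    rw [AlgEquiv.restrictNormal_commutes]
    exact Complex.conj_ofReal _
  · apply (algebraMap Q.L ℂ).injective
    rw [AlgEquiv.restrictNormal_commutes, map_neg]
    exact Complex.conj_I

/-- For every root `x j` and each sign there is an embedding of `F` with `x₁ ↦ x j` and
`i𝔻 ↦ ± i𝔻`. -/
theorem exists_embedding (j : Fin 4) : ∃ φ : Q.F →ₐ[ℚ] Q.L,
    φ Q.rootF = Q.rootL j ∧ φ Q.imDiscF = (-1) ^ (j : ℕ) * (Q.imL * Q.discL) := by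
  obtain ⟨g, hg⟩ := Q.exists_perm (Equiv.swap 0 j)
  obtain ⟨ρ, hρ, hρi⟩ := Q.exists_conj
  have hgr : g (Q.rootL 0) = Q.rootL j := by rw [hg, Equiv.swap_apply_left]
  have hgi : g Q.imL = Q.imL ∨ g Q.imL = -Q.imL := by
    apply sq_eq_sq_iff_eq_or_eq_neg.mp
    rw [← map_pow, imL_sq, map_neg, map_one]
  have hgd : g Q.discL = Q.discL ∨ g Q.discL = -Q.discL := by
    simp only [discL, map_mul, map_sub, hg]
    fin_cases j
    · left; simp
    · right; simp [Equiv.swap_apply_def]; ring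
    · right; simp [Equiv.swap_apply_def]; ring
    · right; simp [Equiv.swap_apply_def]; ring
  have hρd : ρ Q.discL = Q.discL := by simp only [discL, map_mul, map_sub, hρ]
  have hall : ∀ s : Q.L, s = 1 ∨ s = -1 → ∃ h : Q.G, h (Q.rootL 0) = Q.rootL j ∧
      h (Q.imL * Q.discL) = s * (Q.imL * Q.discL) := by
    have h1 : g (Q.imL * Q.discL) = Q.imL * Q.discL ∨
        g (Q.imL * Q.discL) = -(Q.imL * Q.discL) := by
      rw [map_mul]
      rcases hgi with h | h <;> rcases hgd with h' | h' <;> simp [h, h']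
    have h2 : ρ (Q.imL * Q.discL) = -(Q.imL * Q.discL) := by
      rw [map_mul, hρi, hρd, neg_mul]
    rintro s (rfl | rfl) <;> rcases h1 with h1 | h1
    · exact ⟨g, hgr, by rw [h1, one_mul]⟩
    · exact ⟨g.trans ρ, by simp [hgr, hρ], by simp [AlgEquiv.trans_apply, h1, h2, -map_mul]⟩
    · exact ⟨g.trans ρ, by simp [hgr, hρ], by simp [AlgEquiv.trans_apply, h1, h2, -map_mul]⟩
    · exact ⟨g, hgr, by rw [h1, neg_one_mul]⟩
  obtain ⟨h, h1, h2⟩ := hall ((-1) ^ (j : ℕ)) (neg_one_pow_eq_or _ _)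
  exact ⟨(h : Q.L →ₐ[ℚ] Q.L).comp Q.F.val, h1, h2⟩

/-- The embeddings of `F` (with values in `L`). -/
abbrev E : Type := Q.F →ₐ[ℚ] Q.L

/-- The embeddings `φ₁, φ₂, φ₃, φ₄`, which are the vertices of the top face of the cube and are
numbered from `0` here: `φ j` maps `x₁` to `x j` and `i𝔻` to `(-1)ʲ i𝔻`. The other four
embeddings (the bottom face) are their complex conjugates. -/
def φ (j : Fin 4) : Q.E := (Q.exists_embedding j).choose

theorem φ_spec (j : Fin 4) : Q.φ j Q.rootF = Q.rootL j ∧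
    Q.φ j Q.imDiscF = (-1) ^ (j : ℕ) * (Q.imL * Q.discL) := (Q.exists_embedding j).choose_spec

/-- The real vector space `ℝ ⊗ F`, as the space of those `v` in `ℂ ^ E = ℂ ⊗ F` whose components
at complex conjugate embeddings are complex conjugate. -/
def V : Submodule ℝ (Q.E → ℂ) where
  carrier := {v | ∀ ι κ : Q.E, (∀ u, (κ u : ℂ) = starRingEnd ℂ (ι u)) →
    v κ = starRingEnd ℂ (v ι)}
  add_mem' hv hw ι κ h := by
    rw [Pi.add_apply, Pi.add_apply, map_add, hv ι κ h, hw ι κ h]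
  zero_mem' ι κ h := by simp
  smul_mem' r v hv ι κ h := by
    rw [Pi.smul_apply, Pi.smul_apply, hv ι κ h, Complex.real_smul, Complex.real_smul, map_mul,
      Complex.conj_ofReal]

/-- The lattice `Λ` in `V`: the ring of integers of `F`. -/
def Λ : AddSubgroup Q.V where
  carrier := {v | ∃ u : NumberField.RingOfIntegers Q.F, ∀ ι : Q.E, (v : Q.E → ℂ) ι = (ι u : ℂ)}
  add_mem' := by
    rintro v w ⟨u, hu⟩ ⟨u', hu'⟩
    exact ⟨u + u', fun ι => by simp [hu, hu']⟩
  zero_mem' := ⟨0, fun ι => by simp⟩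
  neg_mem' := by
    rintro v ⟨u, hu⟩
    exact ⟨-u, fun ι => by simp [hu]⟩

/-- The one-form `dz_ι` on the torus `V ⧸ Λ`, for an embedding `ι`. -/
def dzE (ι : Q.E) : Torus.InvForm Q.V :=
  Torus.oneForm ((LinearMap.proj ι : (Q.E → ℂ) →ₗ[ℝ] ℂ).comp Q.V.subtype)

/-- The one-form `dz_j`. The complex torus `X` is `V ⧸ Λ` with the complex structure for which
the coordinates `z_j` are holomorphic. -/
def dz (j : Fin 4) : Torus.InvForm Q.V := Q.dzE (Q.φ j)

/-- The complex conjugate one-form of `dz_j`. -/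
def dzbar (j : Fin 4) : Torus.InvForm Q.V :=
  Torus.oneForm (Complex.conjAe.toLinearMap.comp
    ((LinearMap.proj (Q.φ j) : (Q.E → ℂ) →ₗ[ℝ] ℂ).comp Q.V.subtype))

/-- `H^{p,q}(X)`. -/
def hodge (p q : ℕ) : Submodule ℂ (Torus.InvForm Q.V) :=
  Submodule.span ℂ (Set.range Q.dz) ^ p * Submodule.span ℂ (Set.range Q.dzbar) ^ q

/-- The rational classes of type `(p, p)`. -/
def rationalHodge (p : ℕ) : Submodule ℚ (Torus.InvForm Q.V) :=
  Torus.rationalClasses Q.Λ (2 * p) ⊓ (Q.hodge p p).restrictScalars ℚ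

/-- The class `M = 𝔻 (dz₁ dz̄₂ dz₃ dz̄₄ + dz̄₁ dz₂ dz̄₃ dz₄)`. -/
def M : Torus.InvForm Q.V :=
  (Q.disc : ℂ) • (Q.dz 0 * Q.dzbar 1 * Q.dz 2 * Q.dzbar 3 +
    Q.dzbar 0 * Q.dz 1 * Q.dzbar 2 * Q.dz 3)

/-- The class `a₁₃ (x₁ - x₃) dz₁ dz₃ + ⋯` attached to the `G`-orbit of `(1, 3)`, for an element
`a₁₃` of `L` fixed by the stabiliser of `{1, 3}`: the other terms are the images under `G` of the
first one, where `g` maps `dz_ι dz_κ` to `dz_{g ι} dz_{g κ}` and acts on the coefficients through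
its action on `L`. There is one term for each of the `12` unordered pairs in the orbit of
`{1, 3}`; the stabiliser of `{1, 3}` in `G` has order `4`, so that the sum over `G` contains
every term four times. -/
def orbitClass (a : Q.L) : Torus.InvForm Q.V :=
  (1 / 4 : ℂ) • ∑ g : Q.G, ((g (a * (Q.rootL 0 - Q.rootL 2)) : Q.L) : ℂ) •
    (Q.dzE ((g : Q.L →ₐ[ℚ] Q.L).comp (Q.φ 0)) * Q.dzE ((g : Q.L →ₐ[ℚ] Q.L).comp (Q.φ 2)))

/-- `h₃ = x₁ x₃ + x₂ x₄`. -/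
def h₃ : Q.L := Q.rootL 0 * Q.rootL 2 + Q.rootL 1 * Q.rootL 3

/-- The class `A₁`, with `a₁₃ = h₃`. -/
def A₁ : Torus.InvForm Q.V := Q.orbitClass Q.h₃

/-- The class `A₂`, with `a₁₃ = i k 𝔻 h₃`. -/
def A₂ (k : ℤ) : Torus.InvForm Q.V := Q.orbitClass (Q.imL * k * Q.discL * Q.h₃)

end MumfordQuartic

end

/-! An embedding of F is labelled by a root `x j` and a sign ε with i𝔻 ↦ ε i𝔻. The group G acts on
these labels as S₄ × {±1}, and complex conjugation flips ε. Since `φ j` carries the sign (-1)^j, the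
forms `dz 0`, `dzbar 1`, `dz 2`, `dzbar 3` are exactly those with ε = 1. Hence M = 𝔻(ω₊ + ω₋), where
ω_ε is the product of the four one-forms of sign ε, one face of the cube (`M_eq`).

Put f_ε = ∑_{j<k} h_{jk}(x_j - x_k) e_j e_k, with e_j the one-forms of sign ε and h_{jk} = x_j x_k +
x_l x_m for complementary pairs. Summing over G gives A₁ = f₊ + f₋. Since i𝔻 becomes ε i𝔻 on the
face ε, it also gives A₂ = ic𝔻(f₊ - f₋). The square of f_ε is twice a Pfaffian times ω_ε, and this
Pfaffian is 𝔻 (`facePart_sq`). Because (ic𝔻)² = -c²Δ, the mixed terms f₊f₋ cancel in c²Δ A₁² - A₂²,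
which leaves 4c²Δ M (`A₁_sq_sub_A₂_sq`).

On the topological side ch(L ⊕ L⁻¹) = 2 cosh c₁(L), so only even powers of A₁ and A₂ enter. Powers
from the fifth on vanish because f_ε³ = 0, and what remains besides the squares lies in degrees 0
and 8. The Chern–Weil input is that powers of A + dβ and of A differ by exact forms
(`exists_extDeriv_eq_pow_sub_pow`).

A sum over G of conjugate terms is rational because its coefficients in a rational basis are traces
(`sum_gal_eq_sum_trace`); so A₁, A₂ and therefore M are rational. Conversely, a rational two-class
has G-equivariant coefficients. If it is of type (1,1) its part on {φ 0, φ 2} vanishes, and G moves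
this pair to every pair of one face. Restriction to a face therefore kills all rational
(1,1)-classes and their products, but not M (`M_notMem`). -/

set_option linter.unusedSectionVars false

/-! ### Exterior calculus of mixed-degree forms on a torus -/

namespace Torus

section Calculus

variable {V : Type} [NormedAddCommGroup V] [NormedSpace ℝ V] [FiniteDimensional ℝ V]
  {Λ : AddSubgroup V}

theorem smoothOn_univ_iff {f : V ⧸ Λ → ℂ} :
    SmoothOn f Set.univ ↔ ContDiff ℝ ∞ fun v : V => f (QuotientAddGroup.mk v) := by
  rw [SmoothOn, Set.preimage_univ, contDiffOn_univ]

theorem hasDerivAt_line {f : V ⧸ Λ → ℂ} (hf : SmoothOn f Set.univ) (w v : V) :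
    HasDerivAt (fun t : ℝ => f (QuotientAddGroup.mk v + QuotientAddGroup.mk (t • w)))
      (fderiv ℝ (fun u : V => f (QuotientAddGroup.mk u)) v w) 0 := by
  have hd : DifferentiableAt ℝ (fun u : V => f (QuotientAddGroup.mk u)) v :=
    (smoothOn_univ_iff.mp hf).differentiable (by simp) v
  exact hd.hasFDerivAt.hasLineDerivAt w

/-- Translation on the torus lifts to a straight line in V. Smoothness of derivatives and symmetry
of second derivatives are transferred from V through this formula. -/
theorem dirDeriv_mk {f : V ⧸ Λ → ℂ} (hf : SmoothOn f Set.univ) (w v : V) :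
    dirDeriv w f (QuotientAddGroup.mk v) =
      fderiv ℝ (fun u : V => f (QuotientAddGroup.mk u)) v w :=
  (hasDerivAt_line hf w v).deriv

theorem hasDerivAt_dirDeriv {f : V ⧸ Λ → ℂ} (hf : SmoothOn f Set.univ) (w : V) (x : V ⧸ Λ) :
    HasDerivAt (fun t : ℝ => f (x + QuotientAddGroup.mk (t • w))) (dirDeriv w f x) 0 := by
  obtain ⟨v, rfl⟩ := QuotientAddGroup.mk_surjective x
  rw [dirDeriv_mk hf]
  exact hasDerivAt_line hf w v

theorem SmoothOn.dirDeriv {f : V ⧸ Λ → ℂ} (hf : SmoothOn f Set.univ) (w : V) :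
    SmoothOn (Torus.dirDeriv w f) Set.univ := by
  rw [smoothOn_univ_iff, funext (dirDeriv_mk hf w)]
  exact ((smoothOn_univ_iff.mp hf).fderiv_right (m := ∞) (by simp)).clm_apply contDiff_const

theorem dirDeriv_comm {f : V ⧸ Λ → ℂ} (hf : SmoothOn f Set.univ) (w w' : V) (x : V ⧸ Λ) :
    dirDeriv w (dirDeriv w' f) x = dirDeriv w' (dirDeriv w f) x := by
  obtain ⟨v, rfl⟩ := QuotientAddGroup.mk_surjective x
  have hf' := smoothOn_univ_iff.mp hf
  have hd : ∀ u, DifferentiableAt ℝ (fderiv ℝ fun u : V => f (QuotientAddGroup.mk u)) u :=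
    fun u => (hf'.fderiv_right (m := ∞) (by simp)).differentiable (by simp) u
  have key : ∀ a b : V, dirDeriv a (dirDeriv b f) (QuotientAddGroup.mk v) =
      fderiv ℝ (fderiv ℝ fun u : V => f (QuotientAddGroup.mk u)) v a b := by
    intro a b
    rw [dirDeriv_mk (hf.dirDeriv b), funext (dirDeriv_mk hf b),
      fderiv_clm_apply (hd v) (differentiableAt_const b)]
    simp
  rw [key, key]
  exact second_derivative_symmetric
    (fun u => (hf'.differentiable (by simp) u).hasFDerivAt) (hd v).hasFDerivAt w w'

theorem dirDeriv_const (w : V) (z : ℂ) (x : V ⧸ Λ) : dirDeriv w (fun _ => z) x = 0 :=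
  deriv_const _ _

theorem dirDeriv_const_mul (w : V) (z : ℂ) (f : V ⧸ Λ → ℂ) (x : V ⧸ Λ) :
    dirDeriv w (fun y => z * f y) x = z * dirDeriv w f x :=
  deriv_const_mul_field z

theorem dirDeriv_add (w : V) {f g : V ⧸ Λ → ℂ} (hf : SmoothOn f Set.univ)
    (hg : SmoothOn g Set.univ) (x : V ⧸ Λ) :
    dirDeriv w (fun y => f y + g y) x = dirDeriv w f x + dirDeriv w g x :=
  ((hasDerivAt_dirDeriv hf w x).add (hasDerivAt_dirDeriv hg w x)).deriv

theorem dirDeriv_sum {κ : Type*} (s : Finset κ) (w : V) {f : κ → V ⧸ Λ → ℂ}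
    (hf : ∀ k ∈ s, SmoothOn (f k) Set.univ) (x : V ⧸ Λ) :
    dirDeriv w (fun y => ∑ k ∈ s, f k y) x = ∑ k ∈ s, dirDeriv w (f k) x :=
  (HasDerivAt.fun_sum fun k hk => hasDerivAt_dirDeriv (hf k hk) w x).deriv

theorem dirDeriv_mul (w : V) {f g : V ⧸ Λ → ℂ} (hf : SmoothOn f Set.univ)
    (hg : SmoothOn g Set.univ) (x : V ⧸ Λ) :
    dirDeriv w (fun y => f y * g y) x = dirDeriv w f x * g x + f x * dirDeriv w g x := by
  have h := ((hasDerivAt_dirDeriv hf w x).mul (hasDerivAt_dirDeriv hg w x)).deriv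
  rw [zero_smul, QuotientAddGroup.mk_zero, add_zero] at h
  exact h

namespace Form

theorem apply_eq_sum (η : Form Λ) (l : InvForm V →ₗ[ℂ] ℂ) (y : V ⧸ Λ) :
    l (η y) = ∑ k, l (Module.finBasis ℂ (InvForm V) k) *
      (Module.finBasis ℂ (InvForm V)).repr (η y) k := by
  conv_lhs => rw [← (Module.finBasis ℂ (InvForm V)).sum_repr (η y)]
  rw [map_sum]
  exact Finset.sum_congr rfl fun k _ => by rw [map_smul, smul_eq_mul, mul_comm]

theorem Smooth.coord {η : Form Λ} (hη : η.Smooth)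
    (k : Fin (Module.finrank ℂ (InvForm V))) :
    SmoothOn (fun y => (Module.finBasis ℂ (InvForm V)).repr (η y) k) Set.univ :=
  hη ((Module.finBasis ℂ (InvForm V)).coord k)

/-- Frees the coefficientwise derivative from the chosen basis. Since functionals separate invariant
forms, rules for forms reduce to the scalar ones. -/
theorem apply_dirDeriv {η : Form Λ} (hη : η.Smooth) (l : InvForm V →ₗ[ℂ] ℂ) (w : V)
    (x : V ⧸ Λ) : l (Form.dirDeriv w η x) = Torus.dirDeriv w (fun y => l (η y)) x := by
  simp_rw [apply_eq_sum η l]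
  rw [Torus.dirDeriv_sum _ _ fun k _ => smoothOn_univ_iff.mpr
    (contDiff_const.mul (smoothOn_univ_iff.mp (hη.coord k)))]
  rw [Form.dirDeriv, map_sum]
  exact Finset.sum_congr rfl fun k _ => by
    rw [map_smul, smul_eq_mul, mul_comm, dirDeriv_const_mul]

theorem ext_functional {a b : InvForm V} (h : ∀ l : InvForm V →ₗ[ℂ] ℂ, l a = l b) : a = b :=
  (Module.finBasis ℂ (InvForm V)).ext_elem fun k => h ((Module.finBasis ℂ (InvForm V)).coord k)

theorem Smooth.dirDeriv {η : Form Λ} (hη : η.Smooth) (w : V) : (Form.dirDeriv w η).Smooth := by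
  intro l
  simp_rw [apply_dirDeriv hη]
  exact (hη l).dirDeriv w

theorem smooth_const (a : InvForm V) : Form.Smooth (fun _ => a : Form Λ) :=
  fun _ => smoothOn_univ_iff.mpr contDiff_const

theorem Smooth.add {η ξ : Form Λ} (hη : η.Smooth) (hξ : ξ.Smooth) : (η + ξ).Smooth := by
  intro l
  simp only [Pi.add_apply, map_add]
  exact smoothOn_univ_iff.mpr ((smoothOn_univ_iff.mp (hη l)).add (smoothOn_univ_iff.mp (hξ l)))

theorem Smooth.map {η : Form Λ} (hη : η.Smooth) (T : InvForm V →ₗ[ℂ] InvForm V) :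
    Form.Smooth (fun x => T (η x) : Form Λ) :=
  fun l => hη (l.comp T)

theorem Smooth.smul {η : Form Λ} (hη : η.Smooth) (z : ℂ) : (z • η).Smooth :=
  hη.map (z • LinearMap.id)

theorem Smooth.sum {κ : Type*} {s : Finset κ} {η : κ → Form Λ}
    (h : ∀ k ∈ s, (η k).Smooth) : (∑ k ∈ s, η k).Smooth := by
  classical
  induction s using Finset.induction_on with
  | empty => exact smooth_const 0
  | insert a s ha ih =>
    rw [Finset.sum_insert ha]
    exact (h a (Finset.mem_insert_self a s)).add
      (ih fun k hk => h k (Finset.mem_insert_of_mem hk))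

theorem apply_mul_eq_sum (η ξ : Form Λ) (l : InvForm V →ₗ[ℂ] ℂ) (y : V ⧸ Λ) :
    l (η y * ξ y) = ∑ p : Fin (Module.finrank ℂ (InvForm V)) ×
        Fin (Module.finrank ℂ (InvForm V)),
      l (Module.finBasis ℂ (InvForm V) p.1 * Module.finBasis ℂ (InvForm V) p.2) *
        ((Module.finBasis ℂ (InvForm V)).repr (η y) p.1 *
          (Module.finBasis ℂ (InvForm V)).repr (ξ y) p.2) := by
  conv_lhs => rw [← (Module.finBasis ℂ (InvForm V)).sum_repr (η y),
    ← (Module.finBasis ℂ (InvForm V)).sum_repr (ξ y)]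
  simp only [Finset.sum_mul_sum, map_sum, smul_mul_smul_comm, map_smul, smul_eq_mul,
    Fintype.sum_prod_type]
  exact Finset.sum_congr rfl fun i _ => Finset.sum_congr rfl fun j _ => mul_comm _ _

theorem Smooth.mul {η ξ : Form Λ} (hη : η.Smooth) (hξ : ξ.Smooth) : (η * ξ).Smooth := by
  intro l
  simp_rw [Pi.mul_apply, apply_mul_eq_sum]
  exact smoothOn_univ_iff.mpr (ContDiff.sum fun p _ => contDiff_const.mul
    ((smoothOn_univ_iff.mp (hη.coord p.1)).mul (smoothOn_univ_iff.mp (hξ.coord p.2))))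

theorem Smooth.pow {η : Form Λ} (hη : η.Smooth) (k : ℕ) : (η ^ k).Smooth := by
  induction k with
  | zero => rw [pow_zero]; exact smooth_const 1
  | succ k ih => rw [pow_succ]; exact ih.mul hη

theorem dirDeriv_mul {η ξ : Form Λ} (hη : η.Smooth) (hξ : ξ.Smooth) (w : V) (x : V ⧸ Λ) :
    Form.dirDeriv w (η * ξ) x = Form.dirDeriv w η x * ξ x + η x * Form.dirDeriv w ξ x := by
  refine ext_functional fun l => ?_
  have hs : ∀ p : Fin (Module.finrank ℂ (InvForm V)) × Fin (Module.finrank ℂ (InvForm V)),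
      SmoothOn (fun y => (Module.finBasis ℂ (InvForm V)).repr (η y) p.1 *
          (Module.finBasis ℂ (InvForm V)).repr (ξ y) p.2) Set.univ := fun p =>
    smoothOn_univ_iff.mpr
      ((smoothOn_univ_iff.mp (hη.coord p.1)).mul (smoothOn_univ_iff.mp (hξ.coord p.2)))
  rw [apply_dirDeriv (hη.mul hξ), map_add, apply_mul_eq_sum (Form.dirDeriv w η),
    apply_mul_eq_sum η (Form.dirDeriv w ξ)]
  simp_rw [Pi.mul_apply, apply_mul_eq_sum]
  rw [Torus.dirDeriv_sum _ _ fun p _ => smoothOn_univ_iff.mpr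
    (contDiff_const.mul (smoothOn_univ_iff.mp (hs p))), ← Finset.sum_add_distrib]
  refine Finset.sum_congr rfl fun p _ => ?_
  rw [dirDeriv_const_mul, Torus.dirDeriv_mul w (hη.coord p.1) (hξ.coord p.2), ← mul_add]
  congr 2
  · congr 1
    exact (apply_dirDeriv hη ((Module.finBasis ℂ (InvForm V)).coord p.1) w x).symm
  · congr 1
    exact (apply_dirDeriv hξ ((Module.finBasis ℂ (InvForm V)).coord p.2) w x).symm

theorem dirDeriv_map {η : Form Λ} (hη : η.Smooth) (T : InvForm V →ₗ[ℂ] InvForm V) (w : V)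
    (x : V ⧸ Λ) : Form.dirDeriv w (fun y => T (η y)) x = T (Form.dirDeriv w η x) := by
  refine ext_functional fun l => ?_
  rw [apply_dirDeriv (hη.map T)]
  exact (apply_dirDeriv hη (l.comp T) w x).symm

theorem dirDeriv_comm {η : Form Λ} (hη : η.Smooth) (w w' : V) (x : V ⧸ Λ) :
    Form.dirDeriv w (Form.dirDeriv w' η) x = Form.dirDeriv w' (Form.dirDeriv w η) x := by
  refine ext_functional fun l => ?_
  rw [apply_dirDeriv (hη.dirDeriv w'), apply_dirDeriv (hη.dirDeriv w)]
  simp_rw [apply_dirDeriv hη]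
  exact Torus.dirDeriv_comm (hη l) w w' x

theorem dirDeriv_add {η ξ : Form Λ} (hη : η.Smooth) (hξ : ξ.Smooth) (w : V) (x : V ⧸ Λ) :
    Form.dirDeriv w (η + ξ) x = Form.dirDeriv w η x + Form.dirDeriv w ξ x := by
  refine ext_functional fun l => ?_
  rw [apply_dirDeriv (hη.add hξ), map_add, apply_dirDeriv hη, apply_dirDeriv hξ]
  simp only [Pi.add_apply, map_add]
  exact Torus.dirDeriv_add w (hη l) (hξ l) x

theorem dirDeriv_smul (z : ℂ) (η : Form Λ) (w : V) (x : V ⧸ Λ) :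
    Form.dirDeriv w (z • η) x = z • Form.dirDeriv w η x := by
  simp [Form.dirDeriv, dirDeriv_const_mul, Finset.smul_sum, mul_smul]

theorem dirDeriv_const (a : InvForm V) (w : V) (x : V ⧸ Λ) :
    Form.dirDeriv w (fun _ => a) x = 0 := by
  simp [Form.dirDeriv, Torus.dirDeriv_const]

theorem extDeriv_smul (z : ℂ) (η : Form Λ) : Form.extDeriv (z • η) = z • Form.extDeriv η := by
  funext x
  simp [Form.extDeriv, dirDeriv_smul, Finset.smul_sum]

theorem extDeriv_neg (η : Form Λ) : Form.extDeriv (-η) = -Form.extDeriv η := by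
  simpa using extDeriv_smul (-1) η

theorem extDeriv_const (a : InvForm V) : Form.extDeriv (fun _ => a : Form Λ) = 0 := by
  funext x
  simp [Form.extDeriv, dirDeriv_const]

theorem extDeriv_zero : Form.extDeriv (0 : Form Λ) = 0 := extDeriv_const 0

theorem extDeriv_add {η ξ : Form Λ} (hη : η.Smooth) (hξ : ξ.Smooth) :
    Form.extDeriv (η + ξ) = Form.extDeriv η + Form.extDeriv ξ := by
  funext x
  simp [Form.extDeriv, dirDeriv_add hη hξ, mul_add, Finset.sum_add_distrib]

theorem extDeriv_sum {κ : Type*} {s : Finset κ} {η : κ → Form Λ}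
    (h : ∀ k ∈ s, (η k).Smooth) :
    Form.extDeriv (∑ k ∈ s, η k) = ∑ k ∈ s, Form.extDeriv (η k) := by
  classical
  induction s using Finset.induction_on with
  | empty => exact extDeriv_zero
  | insert a s ha ih =>
    have h' : ∀ k ∈ s, (η k).Smooth := fun k hk => h k (Finset.mem_insert_of_mem hk)
    rw [Finset.sum_insert ha, Finset.sum_insert ha,
      extDeriv_add (h a (Finset.mem_insert_self a s)) (Smooth.sum h'), ih h']

theorem Smooth.extDeriv {η : Form Λ} (hη : η.Smooth) : (Form.extDeriv η).Smooth := by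
  have h : Form.extDeriv η = ∑ i, fun x => LinearMap.mulLeft ℂ
      (oneForm (complexify ((Module.finBasis ℝ V).coord i)))
      (Form.dirDeriv (Module.finBasis ℝ V i) η x) := by
    funext x
    simp [Form.extDeriv]
  rw [h]
  exact Smooth.sum fun i _ => (hη.dirDeriv _).map _

/-- Moving a one-form past a form of degree k costs (-1)^k; the grading involution expresses this
sign for mixed degrees, and so enters the Leibniz rule. -/
theorem oneForm_mul (ξ : Covector V) (a : InvForm V) :
    oneForm ξ * a = CliffordAlgebra.involute a * oneForm ξ := by
  induction a using ExteriorAlgebra.induction with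
  | algebraMap r => rw [AlgHom.commutes, Algebra.commutes]
  | ι η =>
    have h : CliffordAlgebra.involute (ExteriorAlgebra.ι ℂ η) = -ExteriorAlgebra.ι ℂ η :=
      CliffordAlgebra.involute_ι η
    rw [h, neg_mul]
    exact eq_neg_of_add_eq_zero_left (ExteriorAlgebra.ι_add_mul_swap ξ η)
  | mul a b ha hb => rw [map_mul, ← mul_assoc, ha, mul_assoc, hb, mul_assoc]
  | add a b ha hb => rw [map_add, mul_add, ha, hb, add_mul]

theorem extDeriv_mul {η ξ : Form Λ} (hη : η.Smooth) (hξ : ξ.Smooth) (x : V ⧸ Λ) :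
    Form.extDeriv (η * ξ) x =
      Form.extDeriv η x * ξ x + CliffordAlgebra.involute (η x) * Form.extDeriv ξ x := by
  simp only [Form.extDeriv, dirDeriv_mul hη hξ, mul_add, Finset.sum_add_distrib, Finset.sum_mul,
    Finset.mul_sum, ← mul_assoc]
  simp only [oneForm_mul _ (η x)]

/-- Second derivatives commute while the coordinate one-forms anticommute, so exchanging the two
summation indices shows that the double sum is its own negative. -/
theorem extDeriv_extDeriv {η : Form Λ} (hη : η.Smooth) :
    Form.extDeriv (Form.extDeriv η) = 0 := by
  funext x
  have h : ∀ w, Form.dirDeriv w (Form.extDeriv η) x =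
      ∑ j, oneForm (complexify ((Module.finBasis ℝ V).coord j)) *
        Form.dirDeriv w (Form.dirDeriv (Module.finBasis ℝ V j) η) x := by
    intro w
    refine ext_functional fun l => ?_
    rw [apply_dirDeriv hη.extDeriv]
    simp only [Form.extDeriv, map_sum]
    have hs : ∀ j, Form.Smooth (fun y => LinearMap.mulLeft ℂ
        (oneForm (complexify ((Module.finBasis ℝ V).coord j)))
        (Form.dirDeriv (Module.finBasis ℝ V j) η y) : Form Λ) := fun j => (hη.dirDeriv _).map _
    refine (Torus.dirDeriv_sum _ _ (fun j _ => hs j l) x).trans ?_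
    refine Finset.sum_congr rfl fun j _ => ?_
    rw [← apply_dirDeriv (hs j), dirDeriv_map (hη.dirDeriv _)]
    rfl
  have hanti : Form.extDeriv (Form.extDeriv η) x = -Form.extDeriv (Form.extDeriv η) x := by
    have hx : Form.extDeriv (Form.extDeriv η) x = ∑ i, ∑ j,
        oneForm (complexify ((Module.finBasis ℝ V).coord i)) *
          oneForm (complexify ((Module.finBasis ℝ V).coord j)) *
          Form.dirDeriv (Module.finBasis ℝ V i) (Form.dirDeriv (Module.finBasis ℝ V j) η) x := by
      rw [Form.extDeriv]
      simp only [h, Finset.mul_sum, mul_assoc]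
    rw [hx]
    nth_rw 1 [Finset.sum_comm]
    simp only [← Finset.sum_neg_distrib]
    refine Finset.sum_congr rfl fun i _ => Finset.sum_congr rfl fun j _ => ?_
    rw [dirDeriv_comm hη (Module.finBasis ℝ V j), ← neg_mul]
    congr 1
    exact eq_neg_of_add_eq_zero_left (ExteriorAlgebra.ι_add_mul_swap _ _)
  have h2 : (2 : ℂ) • Form.extDeriv (Form.extDeriv η) x = 0 := by
    rw [two_smul]
    exact eq_neg_iff_add_eq_zero.mp hanti
  exact (smul_eq_zero.mp h2).resolve_left two_ne_zero

end Form

end Calculus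

end Torus

/-! ### Chern–Weil theory: dual, direct sum, copies, and line bundles -/

noncomputable section

namespace Torus

section Bundles

variable {V : Type} [NormedAddCommGroup V] [NormedSpace ℝ V] [FiniteDimensional ℝ V]
  {Λ : AddSubgroup V}

namespace Form

theorem extDeriv_mul_of_closed {β η : Form Λ} (hβ : β.Smooth) (hη : η.Smooth)
    (h : Form.extDeriv η = 0) : Form.extDeriv (β * η) = Form.extDeriv β * η := by
  funext x
  rw [extDeriv_mul hβ hη, h, Pi.zero_apply, mul_zero, add_zero, Pi.mul_apply]

theorem extDeriv_pow_of_closed {η : Form Λ} (hη : η.Smooth) (h : Form.extDeriv η = 0) (k : ℕ) :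
    Form.extDeriv (η ^ k) = 0 := by
  induction k with
  | zero => rw [pow_zero]; exact extDeriv_const 1
  | succ k ih => rw [pow_succ, extDeriv_mul_of_closed (hη.pow k) hη h, ih, zero_mul]

/-- The powers of a closed form `A + dβ` differ from those of a central constant form `A` by
exact forms. -/
theorem exists_extDeriv_eq_pow_sub_pow {A : InvForm V} (hA : ∀ b, Commute A b) {β : Form Λ}
    (hβ : β.Smooth) (k : ℕ) : ∃ γ : Form Λ, γ.Smooth ∧
      ∀ x, (A + Form.extDeriv β x) ^ k = A ^ k + Form.extDeriv γ x := by
  set a : Form Λ := fun _ => A with ha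
  have has : a.Smooth := smooth_const A
  have had : Form.extDeriv a = 0 := extDeriv_const A
  set τ : Form Λ := a + Form.extDeriv β with hτ
  have hτs : τ.Smooth := has.add hβ.extDeriv
  have hτd : Form.extDeriv τ = 0 := by
    rw [hτ, extDeriv_add has hβ.extDeriv, had, extDeriv_extDeriv hβ, add_zero]
  -- τ^k - a^k = (τ - a) S = dβ · S by the geometric sum, for which τ and a must commute. As S is
  -- closed, this is d(β S).
  set S : Form Λ := ∑ i ∈ Finset.range k, τ ^ i * a ^ (k - 1 - i) with hS
  have hSs : S.Smooth := Smooth.sum fun i _ => (hτs.pow i).mul (has.pow _)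
  have hSd : Form.extDeriv S = 0 := by
    rw [hS, extDeriv_sum fun i _ => (hτs.pow i).mul (has.pow _)]
    refine Finset.sum_eq_zero fun i _ => ?_
    rw [extDeriv_mul_of_closed (hτs.pow i) (has.pow _) (extDeriv_pow_of_closed has had _),
      extDeriv_pow_of_closed hτs hτd, zero_mul]
  refine ⟨β * S, hβ.mul hSs, fun x => ?_⟩
  have hcomm : Commute τ a := funext fun x => ((hA (τ x)).eq).symm
  have h : Form.extDeriv (β * S) = τ ^ k - a ^ k := by
    rw [extDeriv_mul_of_closed hβ hSs hSd, ← hcomm.mul_geom_sum₂, hτ, add_sub_cancel_left]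
  rw [h]
  simp [hτ, ha]

end Form

namespace SmoothBundle

variable {n m : Type} [Fintype n] [DecidableEq n] [Fintype m] [DecidableEq m]

/-- The connection on the dual bundle. -/
def Connection.dual {E : SmoothBundle Λ n} (D : E.Connection) : E.dual.Connection where
  θ i x := -(D.θ i x)ᵀ
  smooth_θ i a b w := (D.smooth_θ i b a w).neg
  compat := fun (i j : E.I) x hx w => by
    -- The dual transition matrix from j to i is the transpose of `g j i`, so the rule needed is the
    -- transpose of the one for the reversed pair.
    have h := congrArg Matrix.transpose (D.compat j i x ⟨hx.2, hx.1⟩ w)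
    rw [Matrix.transpose_mul, Matrix.transpose_add, Matrix.transpose_mul] at h
    change (E.g j i x)ᵀ * -((D.θ j x).map (fun ξ => ξ w))ᵀ =
      (Matrix.of fun a b => dirDeriv w (fun y => E.g j i y a b) x)ᵀ +
        -((D.θ i x).map (fun ξ => ξ w))ᵀ * (E.g j i x)ᵀ
    rw [mul_neg, neg_mul, h]
    abel

/-- The direct sum of two connections. -/
def Connection.directSum {E : SmoothBundle Λ n} {E' : SmoothBundle Λ m} (D : E.Connection)
    (D' : E'.Connection) : (E.directSum E').Connection where
  θ p x := Matrix.fromBlocks (D.θ p.1 x) 0 0 (D'.θ p.2 x)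
  smooth_θ p a b w := by
    rcases a with a | a <;> rcases b with b | b
    · exact (D.smooth_θ p.1 a b w).mono fun v h => h.1
    · exact contDiffOn_const
    · exact contDiffOn_const
    · exact (D'.smooth_θ p.2 a b w).mono fun v h => h.2
  compat p q x hx w := by
    have h := D.compat p.1 q.1 x ⟨hx.1.1, hx.2.1⟩ w
    have h' := D'.compat p.2 q.2 x ⟨hx.1.2, hx.2.2⟩ w
    have hd : (Matrix.of fun a b => dirDeriv w
        (fun y => Matrix.fromBlocks (E.g p.1 q.1 y) 0 0 (E'.g p.2 q.2 y) a b) x) =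
        Matrix.fromBlocks (Matrix.of fun a b => dirDeriv w (fun y => E.g p.1 q.1 y a b) x) 0 0
          (Matrix.of fun a b => dirDeriv w (fun y => E'.g p.2 q.2 y a b) x) := by
      ext a b
      rcases a with a | a <;> rcases b with b | b <;> simp [dirDeriv_const]
    have hz : ∀ (r s : Type), (0 : Matrix r s (Covector V)).map (fun ξ => ξ w) = 0 :=
      fun r s => rfl
    simp only [SmoothBundle.directSum]
    rw [hd, Matrix.fromBlocks_map, Matrix.fromBlocks_map, hz, hz, Matrix.fromBlocks_multiply,
      Matrix.fromBlocks_multiply, h, h', Matrix.fromBlocks_add]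
    simp

/-- The direct sum of `N` copies of a connection. -/
def Connection.copies {E : SmoothBundle Λ n} (N : ℕ) (D : E.Connection) :
    (E.copies N).Connection where
  θ i x := Matrix.blockDiagonal fun _ : Fin N => D.θ i x
  smooth_θ i a b w := by
    by_cases h : a.2 = b.2
    · simp only [Matrix.blockDiagonal_apply, h, if_true]
      exact D.smooth_θ i a.1 b.1 w
    · simp only [Matrix.blockDiagonal_apply, h, if_false]
      exact contDiffOn_const
  compat := fun (i j : E.I) x hx w => by
    have hd : (Matrix.of fun a b => dirDeriv w
        (fun y => Matrix.blockDiagonal (fun _ : Fin N => E.g i j y) a b) x) =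
        Matrix.blockDiagonal fun _ : Fin N =>
          Matrix.of fun a b => dirDeriv w (fun y => E.g i j y a b) x := by
      ext a b
      by_cases h : a.2 = b.2 <;> simp [Matrix.blockDiagonal_apply, h, dirDeriv_const]
    simp only [SmoothBundle.copies]
    rw [hd, Matrix.blockDiagonal_map _ _ (LinearMap.zero_apply w),
      Matrix.blockDiagonal_map _ _ (LinearMap.zero_apply w), ← Matrix.blockDiagonal_mul,
      ← Matrix.blockDiagonal_mul, ← Matrix.blockDiagonal_add]
    exact congrArg Matrix.blockDiagonal (funext fun _ => D.compat i j x hx w)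

/-- `(√-1 / 2π)` times the curvature `dΘ + Θ ∧ Θ` of a connection matrix `Θ`. -/
def normCurvatureOf (Θ : Matrix n n (Form Λ)) : Matrix n n (Form Λ) :=
  (Complex.I / (2 * Real.pi) : ℂ) • (Θ.map Form.extDeriv + Θ * Θ)

/-- The Chern character form of a connection matrix. -/
def chernCharacterFormOf (Θ : Matrix n n (Form Λ)) : Form Λ :=
  ∑ k ∈ Finset.range (Module.finrank ℝ V + 1),
    ((k.factorial : ℂ)⁻¹) • (normCurvatureOf Θ ^ k).trace

theorem Connection.chernCharacterForm_eq {E : SmoothBundle Λ n} (D : E.Connection) (i : E.I) :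
    D.chernCharacterForm i = chernCharacterFormOf (D.form i) :=
  rfl

/-- Transposition reverses the order of the factors inside tr(Θ ∧ Θ), and anticommuting entries turn
this into a sign; the linear term dΘ changes sign anyway. -/
theorem trace_normCurvatureOf_neg_transpose {Θ : Matrix n n (Form Λ)}
    (hΘ : ∀ a b c d, Θ a b * Θ c d = -(Θ c d * Θ a b)) :
    (normCurvatureOf (-Θᵀ)).trace = -(normCurvatureOf Θ).trace := by
  have hmul : (Θᵀ * Θᵀ).trace = -(Θ * Θ).trace := by
    simp only [Matrix.trace, Matrix.diag, Matrix.mul_apply, Matrix.transpose_apply,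
      ← Finset.sum_neg_distrib]
    exact Finset.sum_congr rfl fun a _ => Finset.sum_congr rfl fun b _ => hΘ _ _ _ _
  have hmap : (-Θᵀ).map Form.extDeriv = -(Θ.map Form.extDeriv)ᵀ :=
    Matrix.ext fun a b => Form.extDeriv_neg _
  rw [normCurvatureOf, normCurvatureOf, neg_mul_neg, Matrix.trace_smul, Matrix.trace_smul,
    Matrix.trace_add, Matrix.trace_add, hmul, hmap, Matrix.trace_neg, Matrix.trace_transpose,
    ← neg_add, smul_neg]

theorem Connection.firstChernForm_dual {E : SmoothBundle Λ n} (D : E.Connection) (i : E.I) :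
    D.dual.firstChernForm i = -D.firstChernForm i := by
  have hform : D.dual.form i = -(D.form i)ᵀ :=
    Matrix.ext fun a b => funext fun x => map_neg oneForm _
  refine (congrArg (fun Θ => (normCurvatureOf Θ).trace) hform).trans ?_
  exact trace_normCurvatureOf_neg_transpose fun a b c d => funext fun x =>
    eq_neg_of_add_eq_zero_left (ExteriorAlgebra.ι_add_mul_swap _ _)

theorem HasFirstChernClass.dual {E : SmoothBundle Λ n} {α : InvForm V}
    (h : E.HasFirstChernClass α) : E.dual.HasFirstChernClass (-α) := by
  obtain ⟨D, β, hβ, hD⟩ := h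
  refine ⟨D.dual, -β, by simpa using hβ.smul (-1), fun (i : E.I) x hx => ?_⟩
  refine (congrFun (D.firstChernForm_dual i) x).trans ?_
  rw [Pi.neg_apply, hD i x hx, Form.extDeriv_neg, Pi.neg_apply, neg_add]

theorem normCurvatureOf_fromBlocks (Θ : Matrix n n (Form Λ)) (Θ' : Matrix m m (Form Λ)) :
    normCurvatureOf (Matrix.fromBlocks Θ 0 0 Θ') =
      Matrix.fromBlocks (normCurvatureOf Θ) 0 0 (normCurvatureOf Θ') := by
  have hz : ∀ (r s : Type), (0 : Matrix r s (Form Λ)).map Form.extDeriv = 0 :=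
    fun r s => Matrix.ext fun a b => Form.extDeriv_zero
  rw [normCurvatureOf, Matrix.fromBlocks_map, hz, hz, Matrix.fromBlocks_multiply,
    Matrix.fromBlocks_add, Matrix.fromBlocks_smul]
  simp only [Matrix.mul_zero, Matrix.zero_mul, add_zero, zero_add, smul_zero]
  rfl

theorem chernCharacterFormOf_fromBlocks (Θ : Matrix n n (Form Λ)) (Θ' : Matrix m m (Form Λ)) :
    chernCharacterFormOf (Matrix.fromBlocks Θ 0 0 Θ') =
      chernCharacterFormOf Θ + chernCharacterFormOf Θ' := by
  have htr : ∀ (X : Matrix n n (Form Λ)) (Y : Matrix m m (Form Λ)),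
      (Matrix.fromBlocks X 0 0 Y).trace = X.trace + Y.trace := fun X Y => by
    simp [Matrix.trace]
  simp only [chernCharacterFormOf, normCurvatureOf_fromBlocks, Matrix.fromBlocks_diagonal_pow,
    htr, smul_add, Finset.sum_add_distrib]

theorem Connection.form_directSum {E : SmoothBundle Λ n} {E' : SmoothBundle Λ m}
    (D : E.Connection) (D' : E'.Connection) (i : E.I) (j : E'.I) :
    (D.directSum D').form (i, j) = Matrix.fromBlocks (D.form i) 0 0 (D'.form j) := by
  refine Matrix.ext fun a b => funext fun x => ?_
  rcases a with a | a <;> rcases b with b | b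
  · rfl
  · exact map_zero oneForm
  · exact map_zero oneForm
  · rfl

theorem HasChernCharacter.directSum {E : SmoothBundle Λ n} {E' : SmoothBundle Λ m}
    {η η' : InvForm V} (h : E.HasChernCharacter η) (h' : E'.HasChernCharacter η') :
    (E.directSum E').HasChernCharacter (η + η') := by
  obtain ⟨D, β, hβ, hD⟩ := h
  obtain ⟨D', β', hβ', hD'⟩ := h'
  refine ⟨D.directSum D', β + β', hβ.add hβ', fun p x hx => ?_⟩
  refine (congrFun (congrArg chernCharacterFormOf (D.form_directSum D' p.1 p.2)) x).trans ?_
  rw [chernCharacterFormOf_fromBlocks, Pi.add_apply, ← Connection.chernCharacterForm_eq,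
    ← Connection.chernCharacterForm_eq, hD p.1 x hx.1, hD' p.2 x hx.2, Form.extDeriv_add hβ hβ',
    Pi.add_apply]
  abel

theorem normCurvatureOf_blockDiagonal (N : ℕ) (Θ : Matrix n n (Form Λ)) :
    normCurvatureOf (Matrix.blockDiagonal fun _ : Fin N => Θ) =
      Matrix.blockDiagonal fun _ : Fin N => normCurvatureOf Θ := by
  rw [normCurvatureOf, Matrix.blockDiagonal_map _ _ Form.extDeriv_zero,
    ← Matrix.blockDiagonal_mul, ← Matrix.blockDiagonal_add, ← Matrix.blockDiagonal_smul]
  rfl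

theorem chernCharacterFormOf_blockDiagonal (N : ℕ) (Θ : Matrix n n (Form Λ)) :
    chernCharacterFormOf (Matrix.blockDiagonal fun _ : Fin N => Θ) =
      (N : ℂ) • chernCharacterFormOf Θ := by
  rw [chernCharacterFormOf, chernCharacterFormOf, Finset.smul_sum]
  refine Finset.sum_congr rfl fun k _ => ?_
  have h : (Matrix.blockDiagonal fun _ : Fin N => normCurvatureOf Θ) ^ k =
      Matrix.blockDiagonal fun _ : Fin N => normCurvatureOf Θ ^ k :=
    (Matrix.blockDiagonal_pow (fun _ : Fin N => normCurvatureOf Θ) k).symm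
  rw [normCurvatureOf_blockDiagonal, h, Matrix.trace_blockDiagonal, Finset.sum_const,
    Finset.card_univ, Fintype.card_fin, smul_comm (N : ℂ), Nat.cast_smul_eq_nsmul]

theorem Connection.form_copies {E : SmoothBundle Λ n} (N : ℕ) (D : E.Connection) (i : E.I) :
    (D.copies N).form i = Matrix.blockDiagonal fun _ : Fin N => D.form i := by
  refine Matrix.ext fun a b => funext fun x => ?_
  by_cases h : a.2 = b.2 <;>
    simp [Connection.form, Connection.copies, Matrix.blockDiagonal_apply, h]

theorem HasChernCharacter.copies {E : SmoothBundle Λ n} {η : InvForm V}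
    (h : E.HasChernCharacter η) (N : ℕ) : (E.copies N).HasChernCharacter ((N : ℂ) • η) := by
  obtain ⟨D, β, hβ, hD⟩ := h
  refine ⟨D.copies N, (N : ℂ) • β, hβ.smul _, fun (i : E.I) x hx => ?_⟩
  refine (congrFun (congrArg chernCharacterFormOf (D.form_copies N i)) x).trans ?_
  rw [chernCharacterFormOf_blockDiagonal, Pi.smul_apply, ← Connection.chernCharacterForm_eq,
    hD i x hx, Form.extDeriv_smul, Pi.smul_apply, smul_add]

/-- In rank one the Chern character form is the truncated exponential of the first Chern form A +
dβ. Centrality of A makes each power cohomologous to A^k. -/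
theorem HasFirstChernClass.hasChernCharacter {L : LineBundle Λ} {A : InvForm V}
    (hA : ∀ b, Commute A b) (h : L.HasFirstChernClass A) :
    L.HasChernCharacter (∑ k ∈ Finset.range (Module.finrank ℝ V + 1),
      ((k.factorial : ℂ)⁻¹) • A ^ k) := by
  obtain ⟨D, β, hβ, hD⟩ := h
  choose γ hγs hγ using Form.exists_extDeriv_eq_pow_sub_pow hA hβ
  have hs : ∀ k ∈ Finset.range (Module.finrank ℝ V + 1),
      (((k.factorial : ℂ)⁻¹) • γ k).Smooth := fun k _ => (hγs k).smul _
  refine ⟨D, ∑ k ∈ Finset.range (Module.finrank ℝ V + 1), ((k.factorial : ℂ)⁻¹) • γ k,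
    Form.Smooth.sum hs, fun i x hx => ?_⟩
  have h1 : ∀ k, (D.normCurvature i ^ k).trace = D.firstChernForm i ^ k := by
    have h2 : ∀ k, (D.normCurvature i ^ k) () () = (D.normCurvature i () ()) ^ k := by
      intro k
      induction k with
      | zero => simp
      | succ k ih => simp [pow_succ, Matrix.mul_apply, ih]
    intro k
    simp [Connection.firstChernForm, Matrix.trace, h2]
  rw [Form.extDeriv_sum hs, Connection.chernCharacterForm, Finset.sum_apply, Finset.sum_apply,
    ← Finset.sum_add_distrib]
  refine Finset.sum_congr rfl fun k _ => ?_
  rw [h1, Form.extDeriv_smul, Pi.smul_apply, Pi.smul_apply, Pi.pow_apply, hD i x hx, hγ, smul_add]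

end SmoothBundle

end Bundles

end Torus

end

/-! ### The Galois group as S₄ × {±1} and the embeddings as vertices of a cube -/

noncomputable section

namespace MumfordQuartic

variable (Q : MumfordQuartic)

theorem algHom_ext_F {ι κ : Q.E} (h₁ : ι Q.rootF = κ Q.rootF)
    (h₂ : ι Q.imDiscF = κ Q.imDiscF) : ι = κ := by
  refine IntermediateField.algHom_ext_of_eq_adjoin (S := Q.F) (F := ℚ) rfl ?_
  rintro x (rfl | rfl)
  · exact h₁
  · exact h₂

theorem algHom_ext_L {K : Type*} [Field K] [Algebra ℚ K] {g h : Q.L →ₐ[ℚ] K}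
    (h₁ : ∀ k, g (Q.rootL k) = h (Q.rootL k)) (h₂ : g Q.imL = h Q.imL) : g = h := by
  refine IntermediateField.algHom_ext_of_eq_adjoin (S := Q.L) (F := ℚ) rfl ?_
  rintro x (⟨k, rfl⟩ | rfl)
  · exact h₁ k
  · exact h₂

/-- The Vandermonde determinant has the factors x_k - x_j for j < k; there are six, so reversing all
of them does not change the sign. -/
theorem discL_eq_det : Q.discL = (Matrix.vandermonde Q.rootL).det := by
  rw [Matrix.det_vandermonde, discL, Fin.prod_univ_four, show Finset.Ioi (0 : Fin 4) = {1, 2, 3}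
    from rfl, show Finset.Ioi (1 : Fin 4) = {2, 3} from rfl,
    show Finset.Ioi (2 : Fin 4) = {3} from rfl, show Finset.Ioi (3 : Fin 4) = ∅ from rfl]
  simp
  ring

theorem map_discL {g : Q.L →ₐ[ℚ] Q.L} {σ : Equiv.Perm (Fin 4)}
    (h : ∀ k, g (Q.rootL k) = Q.rootL (σ k)) :
    g Q.discL = ((Equiv.Perm.sign σ : ℤ) : Q.L) * Q.discL := by
  rw [discL_eq_det, AlgHom.map_det, ← Matrix.det_permute]
  congr 1
  ext i j
  simp [Matrix.vandermonde, h]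

theorem coe_discL : (Q.discL : ℂ) = Q.disc := by
  simp [discL, disc, rootL]

theorem disc_pos : 0 < Q.disc := by
  have h : ∀ i j : Fin 4, i < j → 0 < Q.x i - Q.x j := fun i j hij =>
    sub_pos.mpr (Q.strictAnti hij)
  exact mul_pos (mul_pos (mul_pos (mul_pos (mul_pos (h _ _ (by decide)) (h _ _ (by decide)))
    (h _ _ (by decide))) (h _ _ (by decide))) (h _ _ (by decide))) (h _ _ (by decide))

theorem discL_ne_zero : Q.discL ≠ 0 := by
  intro h
  have := Q.coe_discL
  rw [h] at this
  exact Q.disc_pos.ne' (Complex.ofReal_injective this.symm)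

theorem imL_ne_zero : Q.imL ≠ 0 := by
  intro h
  have := Q.imL_sq
  rw [h] at this
  simp at this

theorem imL_mul_discL_ne_zero : Q.imL * Q.discL ≠ 0 := mul_ne_zero Q.imL_ne_zero Q.discL_ne_zero

theorem units_cast_injective {K : Type*} [Field K] [CharZero K] {ε δ : ℤˣ}
    (h : ((ε : ℤ) : K) = ((δ : ℤ) : K)) : ε = δ :=
  Units.ext (Int.cast_injective h)

/-- Any lift of σ multiplies i𝔻 by some sign. Complex conjugation fixes the roots and negates i𝔻, so
composing with it corrects the sign when necessary. -/
theorem exists_gal (σ : Equiv.Perm (Fin 4)) (ε : ℤˣ) :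
    ∃ g : Q.G, (∀ k, g (Q.rootL k) = Q.rootL (σ k)) ∧
      g (Q.imL * Q.discL) = ((ε : ℤ) : Q.L) * (Q.imL * Q.discL) := by
  obtain ⟨g, hg⟩ := Q.exists_perm σ
  obtain ⟨ρ, hρ, hρi⟩ := Q.exists_conj
  have hd : g Q.discL = ((Equiv.Perm.sign σ : ℤ) : Q.L) * Q.discL :=
    Q.map_discL (g := (g : Q.L →ₐ[ℚ] Q.L)) hg
  have hρd : ρ Q.discL = Q.discL := by simp only [discL, map_mul, map_sub, hρ]
  have hi : g Q.imL = Q.imL ∨ g Q.imL = -Q.imL := by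
    apply sq_eq_sq_iff_eq_or_eq_neg.mp
    rw [← map_pow, imL_sq, map_neg, map_one]
  have hδ : ∃ δ : ℤˣ, g (Q.imL * Q.discL) = ((δ : ℤ) : Q.L) * (Q.imL * Q.discL) := by
    rcases hi with hi | hi
    · exact ⟨Equiv.Perm.sign σ, by rw [map_mul, hi, hd]; ring⟩
    · exact ⟨-Equiv.Perm.sign σ, by rw [map_mul, hi, hd]; push_cast; ring⟩
  obtain ⟨δ, hδ⟩ := hδ
  by_cases h : ε = δ
  · exact ⟨g, hg, h ▸ hδ⟩
  · refine ⟨g.trans ρ, fun k => by simp [hg, hρ], ?_⟩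
    rw [Int.units_ne_iff_eq_neg.mp h, AlgEquiv.trans_apply, hδ, map_mul, map_mul, hρi, hρd,
      map_intCast]
    push_cast
    ring

/-- The element of the Galois group of `L` that permutes the roots by `σ` and maps `i𝔻` to
`ε i𝔻`. -/
def galOf (σ : Equiv.Perm (Fin 4)) (ε : ℤˣ) : Q.G := (Q.exists_gal σ ε).choose

theorem galOf_rootL (σ : Equiv.Perm (Fin 4)) (ε : ℤˣ) (k : Fin 4) :
    Q.galOf σ ε (Q.rootL k) = Q.rootL (σ k) := (Q.exists_gal σ ε).choose_spec.1 k

theorem galOf_imDisc (σ : Equiv.Perm (Fin 4)) (ε : ℤˣ) :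
    Q.galOf σ ε (Q.imL * Q.discL) = ((ε : ℤ) : Q.L) * (Q.imL * Q.discL) :=
  (Q.exists_gal σ ε).choose_spec.2

theorem algEquiv_ext {g h : Q.G} (h₁ : ∀ k, g (Q.rootL k) = h (Q.rootL k))
    (h₂ : g (Q.imL * Q.discL) = h (Q.imL * Q.discL)) : g = h := by
  have hd : g Q.discL = h Q.discL := by simp only [discL, map_mul, map_sub, h₁]
  have hne : h Q.discL ≠ 0 := fun h0 => Q.discL_ne_zero (h.injective (h0.trans (map_zero h).symm))
  rw [map_mul, map_mul, hd] at h₂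
  have := Q.algHom_ext_L (g := (g : Q.L →ₐ[ℚ] Q.L)) (h := (h : Q.L →ₐ[ℚ] Q.L)) h₁
    (mul_right_cancel₀ hne h₂)
  exact AlgEquiv.ext fun x => DFunLike.congr_fun this x

theorem exists_map_rootL {K : Type*} [Field K] [Algebra ℚ K] (ι : K →ₐ[ℚ] Q.L) {z : K}
    (hz : Polynomial.aeval z Q.poly = 0) : ∃ j, ι z = Q.rootL j := by
  refine (Q.mem_rootSet_iff _).mp (Polynomial.mem_rootSet.mpr ⟨Q.poly_ne_zero, ?_⟩)
  rw [Polynomial.aeval_algHom_apply, hz, map_zero]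

/-- This turns a sum over G into a sum over permutations and signs. Injectivity needs 𝔻 and i
nonzero; for surjectivity, the effect on 𝔻 is sign σ and the effect on i is ±1. -/
theorem galOf_bijective :
    Function.Bijective fun p : Equiv.Perm (Fin 4) × ℤˣ => Q.galOf p.1 p.2 := by
  constructor
  · rintro ⟨σ, ε⟩ ⟨τ, δ⟩ h
    have h' : Q.galOf σ ε = Q.galOf τ δ := h
    refine Prod.ext (Equiv.ext fun k => Q.rootL_injective ?_) (units_cast_injective (K := Q.L) ?_)
    · rw [← galOf_rootL _ σ ε, ← galOf_rootL _ τ δ, h']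
    · apply mul_right_cancel₀ Q.imL_mul_discL_ne_zero
      rw [← galOf_imDisc _ σ ε, ← galOf_imDisc _ τ δ, h']
  · intro g
    choose s hs using fun k => Q.exists_map_rootL (g : Q.L →ₐ[ℚ] Q.L) (Q.aeval_rootL k)
    have hinj : Function.Injective s := fun k l hkl => Q.rootL_injective
      (g.injective ((hs k).trans ((congrArg Q.rootL hkl).trans (hs l).symm)))
    let σ : Equiv.Perm (Fin 4) := Equiv.ofBijective s (Finite.injective_iff_bijective.mp hinj)
    have hσ : ∀ k, g (Q.rootL k) = Q.rootL (σ k) := hs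
    have hd : g Q.discL = ((Equiv.Perm.sign σ : ℤ) : Q.L) * Q.discL :=
      Q.map_discL (g := (g : Q.L →ₐ[ℚ] Q.L)) hσ
    have hi : g Q.imL = Q.imL ∨ g Q.imL = -Q.imL := by
      apply sq_eq_sq_iff_eq_or_eq_neg.mp
      rw [← map_pow, imL_sq, map_neg, map_one]
    rcases hi with hi | hi
    · refine ⟨(σ, Equiv.Perm.sign σ), Q.algEquiv_ext (fun k => ?_) ?_⟩
      · rw [galOf_rootL, hσ]
      · rw [galOf_imDisc, map_mul, hi, hd]
        ring
    · refine ⟨(σ, -Equiv.Perm.sign σ), Q.algEquiv_ext (fun k => ?_) ?_⟩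
      · rw [galOf_rootL, hσ]
      · rw [galOf_imDisc, map_mul, hi, hd]
        push_cast
        ring

/-- The embedding of `F` that maps `x₁` to `x j` and `i𝔻` to `ε i𝔻`. -/
def emb (j : Fin 4) (ε : ℤˣ) : Q.E :=
  (Q.galOf (Equiv.swap 0 j) ε : Q.L →ₐ[ℚ] Q.L).comp Q.F.val

theorem emb_rootF (j : Fin 4) (ε : ℤˣ) : Q.emb j ε Q.rootF = Q.rootL j :=
  (Q.galOf_rootL _ ε 0).trans (by rw [Equiv.swap_apply_left])

theorem emb_imDiscF (j : Fin 4) (ε : ℤˣ) :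
    Q.emb j ε Q.imDiscF = ((ε : ℤ) : Q.L) * (Q.imL * Q.discL) :=
  Q.galOf_imDisc _ ε

theorem φ_eq_emb (j : Fin 4) : Q.φ j = Q.emb j ((-1) ^ (j : ℕ)) := by
  apply Q.algHom_ext_F
  · rw [emb_rootF, (Q.φ_spec j).1]
  · rw [emb_imDiscF, (Q.φ_spec j).2]
    push_cast
    rfl

/-- In these labels roots and signs are moved independently: G permutes the vertices within a face
and possibly exchanges the two faces. -/
theorem gal_comp_emb (σ : Equiv.Perm (Fin 4)) (ε : ℤˣ) (j : Fin 4) (δ : ℤˣ) :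
    (Q.galOf σ ε : Q.L →ₐ[ℚ] Q.L).comp (Q.emb j δ) = Q.emb (σ j) (δ * ε) := by
  apply Q.algHom_ext_F
  · rw [AlgHom.comp_apply, emb_rootF, emb_rootF]
    exact Q.galOf_rootL σ ε j
  · rw [AlgHom.comp_apply, emb_imDiscF, emb_imDiscF, map_mul, map_intCast]
    refine (congrArg _ (Q.galOf_imDisc σ ε)).trans ?_
    push_cast
    ring

theorem emb_injective {j k : Fin 4} {ε δ : ℤˣ} (h : Q.emb j ε = Q.emb k δ) :
    j = k ∧ ε = δ := by
  constructor
  · apply Q.rootL_injective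
    rw [← emb_rootF _ j ε, ← emb_rootF _ k δ, h]
  · apply units_cast_injective (K := Q.L)
    apply mul_right_cancel₀ Q.imL_mul_discL_ne_zero
    rw [← emb_imDiscF _ j ε, ← emb_imDiscF _ k δ, h]

theorem aeval_rootF : Polynomial.aeval Q.rootF Q.poly = 0 := by
  apply Subtype.val_injective
  have h := Polynomial.aeval_algHom_apply Q.F.val Q.rootF Q.poly
  exact h.symm.trans (Q.aeval_rootL 0)

variable {Q}

/-- The square of i𝔻 is the rational number -Δ, so an embedding can only send i𝔻 to ± i𝔻. -/
theorem exists_eq_emb {Δ : ℕ} (hΔ : Q.disc ^ 2 = Δ) (ι : Q.E) : ∃ j ε, ι = Q.emb j ε := by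
  obtain ⟨j, hj⟩ := Q.exists_map_rootL ι Q.aeval_rootF
  have hd : Q.discL ^ 2 = Δ := by
    apply Subtype.val_injective
    have h := congrArg (fun r : ℝ => (r : ℂ)) hΔ
    simp only [Complex.ofReal_pow, Complex.ofReal_natCast] at h
    rw [← coe_discL] at h
    exact h
  have hsL : (Q.imL * Q.discL) ^ 2 = -(Δ : Q.L) := by
    rw [mul_pow, imL_sq, hd, neg_one_mul]
  have hsF : Q.imDiscF ^ 2 = -(Δ : Q.F) := Subtype.val_injective (hsL.trans (by simp))
  have hs : (ι Q.imDiscF) ^ 2 = (Q.imL * Q.discL) ^ 2 := by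
    rw [← map_pow, hsF, hsL, map_neg, map_natCast]
  rcases sq_eq_sq_iff_eq_or_eq_neg.mp hs with h | h
  · exact ⟨j, 1, Q.algHom_ext_F (hj.trans (Q.emb_rootF j 1).symm) (by rw [emb_imDiscF, h]; simp)⟩
  · exact ⟨j, -1, Q.algHom_ext_F (hj.trans (Q.emb_rootF j _).symm) (by rw [emb_imDiscF, h]; simp)⟩

/-- Fixing all roots forces 𝔻 to be fixed; negating i𝔻 then negates i, and complex conjugation
agrees with this on generators of L. -/
theorem coe_galOf_conj (u : Q.L) : (Q.galOf 1 (-1) u : ℂ) = starRingEnd ℂ (u : ℂ) := by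
  have hd : Q.galOf 1 (-1) Q.discL = Q.discL := by
    simp only [discL, map_mul, map_sub, galOf_rootL, Equiv.Perm.one_apply]
  have hi : Q.galOf 1 (-1) Q.imL = -Q.imL := by
    have h := Q.galOf_imDisc 1 (-1)
    rw [map_mul, hd, ← mul_assoc] at h
    simpa using mul_right_cancel₀ Q.discL_ne_zero h
  have := Q.algHom_ext_L (g := Q.L.val.comp (Q.galOf 1 (-1) : Q.L →ₐ[ℚ] Q.L))
    (h := ((Complex.conjAe.restrictScalars ℚ : ℂ ≃ₐ[ℚ] ℂ) : ℂ →ₐ[ℚ] ℂ).comp Q.L.val)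
    (fun k => ?_) ?_
  · exact DFunLike.congr_fun this u
  · refine (congrArg Subtype.val (Q.galOf_rootL 1 (-1) k)).trans ?_
    exact (Complex.conj_ofReal _).symm
  · refine (congrArg Subtype.val hi).trans ?_
    exact Complex.conj_I.symm

variable (Q) in
/-- The complex conjugate of an embedding. -/
def conjE (ι : Q.E) : Q.E := (Q.galOf 1 (-1) : Q.L →ₐ[ℚ] Q.L).comp ι

theorem coe_conjE (ι : Q.E) (u : Q.F) : (Q.conjE ι u : ℂ) = starRingEnd ℂ (ι u : ℂ) :=
  coe_galOf_conj (ι u)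

theorem conjE_emb (j : Fin 4) (ε : ℤˣ) : Q.conjE (Q.emb j ε) = Q.emb j (-ε) := by
  rw [conjE, gal_comp_emb, Equiv.Perm.one_apply, mul_neg_one]

theorem conjE_conjE (ι : Q.E) : Q.conjE (Q.conjE ι) = ι :=
  AlgHom.ext fun u => Subtype.val_injective (by simp [coe_conjE])

theorem conjE_ne {Δ : ℕ} (hΔ : Q.disc ^ 2 = Δ) (ι : Q.E) : Q.conjE ι ≠ ι := by
  obtain ⟨j, ε, rfl⟩ := exists_eq_emb hΔ ι
  rw [conjE_emb]
  intro h
  exact absurd (Q.emb_injective h).2 (by clear h; revert ε; decide)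

theorem mem_V_iff {v : Q.E → ℂ} :
    v ∈ Q.V ↔ ∀ ι, v (Q.conjE ι) = starRingEnd ℂ (v ι) := by
  constructor
  · exact fun h ι => h ι _ (coe_conjE ι)
  · intro h ι κ hκ
    have : κ = Q.conjE ι := AlgHom.ext fun u => Subtype.val_injective
      ((hκ u).trans (coe_conjE ι u).symm)
    rw [this, h]

end MumfordQuartic

end

/-! ### The basis of complex covectors given by the embeddings -/

noncomputable section

namespace MumfordQuartic

variable (Q : MumfordQuartic)

/-- The covector of which `dzE ι` is the one-form. -/
def covec (ι : Q.E) : Torus.Covector Q.V :=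
  (LinearMap.proj ι : (Q.E → ℂ) →ₗ[ℝ] ℂ).comp Q.V.subtype

theorem dzE_eq (ι : Q.E) : Q.dzE ι = Torus.oneForm (Q.covec ι) := rfl

@[simp]
theorem covec_apply (ι : Q.E) (v : Q.V) : Q.covec ι v = (v : Q.E → ℂ) ι := rfl

theorem dz_eq (j : Fin 4) : Q.dz j = Q.dzE (Q.emb j ((-1) ^ (j : ℕ))) := by
  rw [dz, φ_eq_emb]

theorem dzbar_eq (j : Fin 4) : Q.dzbar j = Q.dzE (Q.emb j (-(-1) ^ (j : ℕ))) := by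
  rw [dzbar, dzE_eq, φ_eq_emb]
  refine congrArg _ (LinearMap.ext fun v => ?_)
  rw [← conjE_emb]
  exact (mem_V_iff.mp v.2 _).symm

open Classical in
/-- The vector of `V` with component `z` at `ι`, the conjugate component at the conjugate of `ι`,
and zero elsewhere. -/
def single (ι : Q.E) : ℂ →ₗ[ℝ] Q.V where
  toFun z := ⟨fun κ => (if κ = ι then z else 0) +
    (if κ = Q.conjE ι then starRingEnd ℂ z else 0), by
      rw [mem_V_iff]
      intro κ
      have h1 : Q.conjE κ = ι ↔ κ = Q.conjE ι := ⟨fun h => by rw [← h, conjE_conjE],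
        fun h => by rw [h, conjE_conjE]⟩
      have h2 : Q.conjE κ = Q.conjE ι ↔ κ = ι :=
        ⟨fun h => by rw [← conjE_conjE κ, h, conjE_conjE], fun h => by rw [h]⟩
      simp only [h1, h2, map_add, apply_ite (starRingEnd ℂ), map_zero, Complex.conj_conj]
      exact add_comm _ _⟩
  map_add' z w := Subtype.ext (funext fun κ => by
    simp only [Submodule.coe_add, Pi.add_apply, map_add]
    split_ifs <;> ring)
  map_smul' r z := Subtype.ext (funext fun κ => by
    simp only [Submodule.coe_smul, Pi.smul_apply, RingHom.id_apply, Complex.real_smul, map_mul,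
      Complex.conj_ofReal]
    split_ifs <;> ring)

variable {Q}

open Classical in
theorem single_apply (ι κ : Q.E) (z : ℂ) : (Q.single ι z : Q.E → ℂ) κ =
    (if κ = ι then z else 0) + (if κ = Q.conjE ι then starRingEnd ℂ z else 0) := rfl

theorem single_conjE (ι : Q.E) (z : ℂ) :
    Q.single (Q.conjE ι) z = Q.single ι (starRingEnd ℂ z) := by
  refine Subtype.ext (funext fun κ => ?_)
  rw [single_apply, single_apply, conjE_conjE, Complex.conj_conj, add_comm]

/-- The factor 2 arises because ι and its conjugate contribute the same vector. -/
theorem sum_single (v : Q.V) : ∑ ι, Q.single ι ((v : Q.E → ℂ) ι) = (2 : ℝ) • v := by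
  classical
  refine Subtype.ext (funext fun κ => ?_)
  have h : ∀ ι : Q.E, (κ = Q.conjE ι ↔ ι = Q.conjE κ) := fun ι =>
    ⟨fun h => by rw [h, conjE_conjE], fun h => by rw [h, conjE_conjE]⟩
  rw [AddSubmonoidClass.coe_finsetSum, Finset.sum_apply]
  simp only [single_apply, Finset.sum_add_distrib, h, Finset.sum_ite_eq, Finset.sum_ite_eq',
    Finset.mem_univ, if_true, mem_V_iff.mp v.2, Complex.conj_conj, Submodule.coe_smul,
    Pi.smul_apply, Complex.real_smul]
  push_cast
  ring

/-- The coordinates of a covector with respect to the basis `covec`. -/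
def coord (ι : Q.E) : Torus.Covector Q.V →ₗ[ℂ] ℂ where
  toFun ξ := (ξ (Q.single ι 1) - Complex.I * ξ (Q.single ι Complex.I)) / 2
  map_add' ξ η := by simp only [LinearMap.add_apply]; ring
  map_smul' z ξ := by simp only [LinearMap.smul_apply, smul_eq_mul, RingHom.id_apply]; ring

open Classical in
-- `coord ι` extracts the ℂ-linear part of a covector along z ↦ `single ι z`. The conjugate
-- embedding is antilinear along this line, hence is annihilated.
theorem coord_covec {Δ : ℕ} (hΔ : Q.disc ^ 2 = Δ) (ι κ : Q.E) :
    coord ι (Q.covec κ) = if κ = ι then 1 else 0 := by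
  have hne := conjE_ne hΔ ι
  simp only [coord, LinearMap.coe_mk, AddHom.coe_mk, covec_apply, single_apply]
  by_cases h : κ = ι
  · rw [h, if_pos rfl, if_neg hne.symm, if_pos rfl, if_neg hne.symm]
    linear_combination (-1 / 2) * Complex.I_sq
  · simp only [if_neg h]
    split_ifs
    · rw [map_one, Complex.conj_I]
      linear_combination (1 / 2) * Complex.I_sq
    · simp

theorem sum_coord_smul (ξ : Torus.Covector Q.V) : ∑ ι, coord ι ξ • Q.covec ι = ξ := by
  refine LinearMap.ext fun v => ?_
  have hc : ∀ (f : Q.E → ℂ), ∑ ι, f (Q.conjE ι) = ∑ ι, f ι := fun f =>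
    Equiv.sum_comp (Function.Involutive.toPerm Q.conjE conjE_conjE) f
  -- Reindexing by conjugation writes the same sum with antilinear parts. Adding the two versions
  -- reassembles the full values of ξ on the vectors `single`.
  have h1 : ∑ ι, coord ι ξ * (v : Q.E → ℂ) ι =
      ∑ ι, (ξ (Q.single ι 1) + Complex.I * ξ (Q.single ι Complex.I)) / 2 *
        starRingEnd ℂ ((v : Q.E → ℂ) ι) := by
    rw [← hc]
    refine Finset.sum_congr rfl fun ι _ => ?_
    simp only [coord, LinearMap.coe_mk, AddHom.coe_mk, single_conjE, mem_V_iff.mp v.2, map_one,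
      Complex.conj_I, map_neg]
    ring
  have h2 : ∀ ι, ξ (Q.single ι ((v : Q.E → ℂ) ι)) =
      ((v : Q.E → ℂ) ι).re * ξ (Q.single ι 1) +
        ((v : Q.E → ℂ) ι).im * ξ (Q.single ι Complex.I) := by
    intro ι
    have : (v : Q.E → ℂ) ι = ((v : Q.E → ℂ) ι).re • (1 : ℂ) +
        ((v : Q.E → ℂ) ι).im • Complex.I := by
      simp
    conv_lhs => rw [this]
    rw [map_add, map_add, map_smul, map_smul, map_smul, map_smul, Complex.real_smul,
      Complex.real_smul]
  have h3 : (2 : ℂ) * ξ v = ∑ ι, ξ (Q.single ι ((v : Q.E → ℂ) ι)) := by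
    rw [← map_sum, sum_single, map_smul, Complex.real_smul]
    norm_num
  have h4 : ∑ ι, coord ι ξ * (v : Q.E → ℂ) ι = ξ v := by
    have h5 : (2 : ℂ) * ∑ ι, coord ι ξ * (v : Q.E → ℂ) ι = 2 * ξ v := by
      rw [h3, two_mul]
      nth_rw 2 [h1]
      rw [← Finset.sum_add_distrib]
      refine Finset.sum_congr rfl fun ι _ => ?_
      rw [h2]
      simp only [coord, LinearMap.coe_mk, AddHom.coe_mk]
      rw [Complex.re_eq_add_conj, Complex.im_eq_sub_conj]
      have hI : Complex.I ≠ 0 := Complex.I_ne_zero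
      field_simp
      linear_combination (-(ξ (Q.single ι Complex.I)) * ((v : Q.E → ℂ) ι -
        starRingEnd ℂ ((v : Q.E → ℂ) ι))) * Complex.I_sq
    exact mul_left_cancel₀ two_ne_zero h5
  simpa [LinearMap.sum_apply] using h4

theorem linearIndependent_covec {Δ : ℕ} (hΔ : Q.disc ^ 2 = Δ) :
    LinearIndependent ℂ Q.covec := by
  classical
  rw [Fintype.linearIndependent_iff]
  intro c hc ι
  have h := congrArg (coord ι) hc
  simpa [map_sum, coord_covec hΔ] using h

/-- One face already supplies four independent covectors. This crude bound is enough for the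
truncated exponential in the Chern character to reach the fourth power. -/
theorem four_le_finrank_V {Δ : ℕ} (hΔ : Q.disc ^ 2 = Δ) :
    4 ≤ Module.finrank ℝ Q.V := by
  have h1 : Fintype.card (Fin 4) ≤ Fintype.card Q.E :=
    Fintype.card_le_of_injective (fun j => Q.emb j 1) fun j k h => (Q.emb_injective h).1
  have h2 := (linearIndependent_covec hΔ).fintype_card_le_finrank
  rw [Module.finrank_linearMap_self] at h2
  simpa using h1.trans h2

end MumfordQuartic

end

/-! ### Rational classes: traces and equivariant coefficients -/

noncomputable section

namespace Torus

variable {V : Type} [NormedAddCommGroup V] [NormedSpace ℝ V]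
  {Λ : AddSubgroup V}

theorem ratCast_smul_mem {k : ℕ} (q : ℚ) {η : InvForm V} (h : η ∈ rationalClasses Λ k) :
    (q : ℂ) • η ∈ rationalClasses Λ k := by
  rw [Rat.cast_smul_eq_qsmul]
  exact Submodule.smul_mem _ q h

theorem mul_mem_rationalClasses {j k : ℕ} {η ξ : InvForm V} (hη : η ∈ rationalClasses Λ j)
    (hξ : ξ ∈ rationalClasses Λ k) : η * ξ ∈ rationalClasses Λ (j + k) := by
  rw [rationalClasses, pow_add]
  exact Submodule.mul_mem_mul hη hξ

theorem pow_mem_rationalClasses {j : ℕ} {η : InvForm V} (hη : η ∈ rationalClasses Λ j) (k : ℕ) :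
    η ^ k ∈ rationalClasses Λ (j * k) := by
  rw [rationalClasses, pow_mul]
  exact Submodule.pow_mem_pow _ hη k

theorem oneForm_mem_rationalClasses {ξ : Covector V} (h : ∀ v ∈ Λ, ∃ q : ℚ, ξ v = q) :
    oneForm ξ ∈ rationalClasses Λ 1 := by
  rw [rationalClasses, pow_one]
  exact Submodule.subset_span (Set.mem_image_of_mem _ h)

theorem sum_mem_rationalClasses_two {κ : Type*} [Fintype κ] {ξ : κ → Covector V}
    (h : ∀ m, ∀ v ∈ Λ, ∃ q : ℚ, ξ m v = q) (r : κ → κ → ℚ) :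
    ∑ m, ∑ n, (r m n : ℂ) • (oneForm (ξ m) * oneForm (ξ n)) ∈ rationalClasses Λ 2 :=
  Submodule.sum_mem _ fun m _ => Submodule.sum_mem _ fun n _ =>
    ratCast_smul_mem _ (mul_mem_rationalClasses (oneForm_mem_rationalClasses (h m))
      (oneForm_mem_rationalClasses (h n)))

end Torus

namespace MumfordQuartic

variable (Q : MumfordQuartic)

theorem numberField_F : NumberField Q.F where

theorem isGalois_L : IsGalois ℚ Q.L where

attribute [local instance] numberField_F isGalois_L

theorem coe_sum_mul {κ : Type*} (s : Finset κ) (x y : κ → Q.L) :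
    ((∑ m ∈ s, x m * y m : Q.L) : ℂ) = ∑ m ∈ s, (x m : ℂ) * (y m : ℂ) :=
  (map_sum Q.L.val _ s).trans (Finset.sum_congr rfl fun m _ => map_mul Q.L.val (x m) (y m))

theorem coe_ratCast (q : ℚ) : ((algebraMap ℚ Q.L q : Q.L) : ℂ) = q := rfl

theorem card_E : Fintype.card Q.E = Module.finrank ℚ Q.F :=
  AlgHom.card_of_splits ℚ Q.F Q.L fun u => by
    rw [← minpoly.algebraMap_eq (A := ℚ) (algebraMap Q.F Q.L).injective u]
    exact Normal.splits Q.normal_L _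

/-- The embeddings form a basis of the space of `ℚ`-linear maps from `F` to `L`. -/
def embBasis : Module.Basis Q.E Q.L (Q.F →ₗ[ℚ] Q.L) :=
  have : Nonempty Q.E := ⟨Q.φ 0⟩
  basisOfLinearIndependentOfCardEqFinrank (linearIndependent_algHom_toLinearMap ℚ Q.F Q.L)
    (by rw [Module.finrank_linearMap_self, card_E])

theorem embBasis_apply (ι : Q.E) : Q.embBasis ι = ι.toLinearMap := by
  simp [embBasis]

theorem sum_embBasis_repr (f : Q.F →ₗ[ℚ] Q.L) (u : Q.F) :
    ∑ ι, Q.embBasis.repr f ι * ι u = f u := by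
  conv_rhs => rw [← Q.embBasis.sum_repr f]
  simp [LinearMap.sum_apply, embBasis_apply]

theorem embBasis_repr_eq {f : Q.F →ₗ[ℚ] Q.L} {c : Q.E → Q.L} (h : ∀ u, ∑ ι, c ι * ι u = f u) :
    ⇑(Q.embBasis.repr f) = c := by
  have hf : f = ∑ ι, c ι • Q.embBasis ι := by
    ext u
    rw [← h]
    simp [LinearMap.sum_apply, embBasis_apply]
  rw [hf]
  exact Q.embBasis.repr_sum_self c

/-- The coefficients of a rational linear form on `F` are equivariant. -/
theorem embBasis_repr_equivariant (f : Q.F →ₗ[ℚ] ℚ) (g : Q.G) (ι : Q.E) :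
    Q.embBasis.repr ((Algebra.linearMap ℚ Q.L).comp f) ((g : Q.L →ₐ[ℚ] Q.L).comp ι) =
      g (Q.embBasis.repr ((Algebra.linearMap ℚ Q.L).comp f) ι) := by
  let e : Q.E ≃ Q.E :=
    { toFun := fun κ => (g : Q.L →ₐ[ℚ] Q.L).comp κ
      invFun := fun κ => (g.symm : Q.L →ₐ[ℚ] Q.L).comp κ
      left_inv := fun κ => AlgHom.ext fun u => g.symm_apply_apply (κ u)
      right_inv := fun κ => AlgHom.ext fun u => g.apply_symm_apply (κ u) }
  -- Applying g to ∑ c_κ κ(u) = f(u) leaves the rational right-hand side fixed and permutes the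
  -- embeddings; uniqueness of coordinates gives equivariance.
  have h := Q.embBasis_repr_eq (f := (Algebra.linearMap ℚ Q.L).comp f)
    (c := fun κ => g (Q.embBasis.repr ((Algebra.linearMap ℚ Q.L).comp f) (e.symm κ))) fun u => by
      have h1 := congrArg g (Q.sum_embBasis_repr ((Algebra.linearMap ℚ Q.L).comp f) u)
      rw [map_sum] at h1
      have h2 : g (((Algebra.linearMap ℚ Q.L).comp f) u) =
          ((Algebra.linearMap ℚ Q.L).comp f) u := g.commutes (f u)
      rw [h2] at h1
      rw [← h1, ← Equiv.sum_comp e]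
      refine Finset.sum_congr rfl fun κ _ => ?_
      rw [Equiv.symm_apply_apply, map_mul]
      rfl
  have h3 := congrFun h (e ι)
  rw [Equiv.symm_apply_apply] at h3
  exact h3

/-- The lattice vector of an algebraic integer. -/
def latticeVec (u : NumberField.RingOfIntegers Q.F) : Q.V :=
  ⟨fun ι => (ι u : ℂ), mem_V_iff.mpr fun ι => coe_conjE ι u⟩

theorem latticeVec_mem (u : NumberField.RingOfIntegers Q.F) : Q.latticeVec u ∈ Q.Λ :=
  ⟨u, fun _ => rfl⟩

/-- The index set of an integral basis of `F`. -/
abbrev BasisIndex : Type := Module.Free.ChooseBasisIndex ℤ (NumberField.RingOfIntegers Q.F)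

/-- The `m`-th coordinate with respect to the integral basis, as a linear map to `L`. -/
def integralCoord (m : Q.BasisIndex) : Q.F →ₗ[ℚ] Q.L :=
  (Algebra.linearMap ℚ Q.L).comp ((NumberField.integralBasis Q.F).coord m)

/-- The covectors dual to an integral basis of `F`. -/
def rationalCovec (m : Q.BasisIndex) : Torus.Covector Q.V :=
  ∑ ι, ((Q.embBasis.repr (Q.integralCoord m) ι : Q.L) : ℂ) • Q.covec ι

theorem rationalCovec_mem (m : Q.BasisIndex) (v : Q.V) (hv : v ∈ Q.Λ) :
    ∃ q : ℚ, Q.rationalCovec m v = q := by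
  obtain ⟨u, hu⟩ := hv
  refine ⟨(NumberField.integralBasis Q.F).coord m u, ?_⟩
  have h := congrArg Subtype.val (Q.sum_embBasis_repr (Q.integralCoord m) u)
  rw [coe_sum_mul] at h
  simp only [rationalCovec, LinearMap.sum_apply, LinearMap.smul_apply, covec_apply, hu,
    smul_eq_mul]
  exact h

theorem sum_integralCoord (ι : Q.E) :
    ∑ m, ι (NumberField.integralBasis Q.F m) • Q.integralCoord m = Q.embBasis ι := by
  refine LinearMap.ext fun u => ?_
  rw [embBasis_apply]
  conv_rhs => rw [← (NumberField.integralBasis Q.F).sum_repr u]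
  simp only [AlgHom.toLinearMap_apply, map_sum, map_smul, LinearMap.sum_apply,
    LinearMap.smul_apply, smul_eq_mul, integralCoord, LinearMap.comp_apply,
    Algebra.linearMap_apply, Module.Basis.coord_apply]
  exact Finset.sum_congr rfl fun m _ => by rw [Algebra.smul_def, mul_comm]

open Classical in
theorem sum_mul_embBasis_repr (ι κ : Q.E) : ∑ m, ι (NumberField.integralBasis Q.F m) *
    Q.embBasis.repr (Q.integralCoord m) κ = if ι = κ then 1 else 0 := by
  rw [← Finsupp.single_apply, ← Q.embBasis.repr_self ι, ← sum_integralCoord, map_sum,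
    Finsupp.finsetSum_apply]
  exact Finset.sum_congr rfl fun m _ => by rw [map_smul, Finsupp.smul_apply, smul_eq_mul]

/-- The matrix of values ι(ω_m) on an integral basis is inverse to the matrix that defines the
`rationalCovec m`. -/
theorem covec_eq_sum (ι : Q.E) :
    Q.covec ι = ∑ m, ((ι (NumberField.integralBasis Q.F m) : Q.L) : ℂ) • Q.rationalCovec m := by
  classical
  simp only [rationalCovec, Finset.smul_sum, smul_smul]
  rw [Finset.sum_comm]
  simp only [← Finset.sum_smul, ← coe_sum_mul, sum_mul_embBasis_repr]
  rw [Finset.sum_eq_single ι]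
  · rw [if_pos rfl]
    exact (one_smul ℂ _).symm
  · intro κ _ hκ
    rw [if_neg hκ.symm]
    exact zero_smul ℂ _
  · exact fun h => absurd (Finset.mem_univ ι) h

variable {Q}

/-- A rational covector is a combination of the `covec ι` with equivariant coefficients in `L`. -/
theorem exists_equivariant_of_rational {ξ : Torus.Covector Q.V}
    (hξ : ∀ v ∈ Q.Λ, ∃ q : ℚ, ξ v = q) : ∃ c : Q.E → Q.L,
      (∀ (g : Q.G) ι, c ((g : Q.L →ₐ[ℚ] Q.L).comp ι) = g (c ι)) ∧
        ξ = ∑ ι, ((c ι : Q.L) : ℂ) • Q.covec ι := by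
  choose q hq using fun m : Q.BasisIndex =>
    hξ _ (Q.latticeVec_mem (NumberField.RingOfIntegers.basis Q.F m))
  -- After both changes of basis, the coefficient of `rationalCovec m` is the value of ξ on the m-th
  -- lattice vector, which is rational by hypothesis.
  have h1 : ξ = ∑ m, (q m : ℂ) • Q.rationalCovec m := by
    conv_lhs => rw [← sum_coord_smul ξ]
    simp only [covec_eq_sum, Finset.smul_sum, smul_smul]
    rw [Finset.sum_comm]
    refine Finset.sum_congr rfl fun m _ => ?_
    rw [← Finset.sum_smul, ← hq]
    congr 1
    conv_rhs => rw [← sum_coord_smul ξ]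
    rw [LinearMap.sum_apply]
    refine Finset.sum_congr rfl fun ι _ => ?_
    rw [LinearMap.smul_apply, smul_eq_mul, NumberField.integralBasis_apply]
    rfl
  refine ⟨fun ι => ∑ m, algebraMap ℚ Q.L (q m) * Q.embBasis.repr (Q.integralCoord m) ι,
    fun g ι => ?_, ?_⟩
  · rw [map_sum]
    refine Finset.sum_congr rfl fun m _ => ?_
    rw [map_mul, AlgEquiv.commutes, integralCoord, embBasis_repr_equivariant]
  · rw [h1]
    simp only [rationalCovec, Finset.smul_sum, smul_smul]
    rw [Finset.sum_comm]
    refine Finset.sum_congr rfl fun ι _ => ?_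
    rw [← Finset.sum_smul, coe_sum_mul]
    rfl

theorem coe_trace (z : Q.L) :
    ((Algebra.trace ℚ Q.L z : ℚ) : ℂ) = ∑ g : Q.G, ((g z : Q.L) : ℂ) := by
  have := congrArg Subtype.val (trace_eq_sum_automorphisms (K := ℚ) z)
  rw [coe_ratCast] at this
  exact this.trans (map_sum Q.L.val _ _)

/-- Expanding each one-form in the rational basis collects the sum over G into ∑ g(z) = Tr(z), which
is rational for z in L. -/
theorem sum_gal_eq_sum_trace (y : Q.L) (ι κ : Q.E) :
    (∑ g : Q.G, ((g y : Q.L) : ℂ) • (Q.dzE ((g : Q.L →ₐ[ℚ] Q.L).comp ι) *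
      Q.dzE ((g : Q.L →ₐ[ℚ] Q.L).comp κ))) =
      ∑ m, ∑ n, ((Algebra.trace ℚ Q.L (y * (ι (NumberField.integralBasis Q.F m) *
        κ (NumberField.integralBasis Q.F n))) : ℚ) : ℂ) •
          (Torus.oneForm (Q.rationalCovec m) * Torus.oneForm (Q.rationalCovec n)) := by
  simp only [dzE_eq, covec_eq_sum, map_sum, map_smul, Finset.sum_mul_sum, smul_mul_smul_comm,
    Finset.smul_sum, smul_smul, coe_trace, Finset.sum_smul]
  rw [Finset.sum_comm]
  refine Finset.sum_congr rfl fun m _ => ?_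
  rw [Finset.sum_comm]
  refine Finset.sum_congr rfl fun n _ => Finset.sum_congr rfl fun g _ => ?_
  rw [map_mul, map_mul]
  rfl

theorem sum_gal_rational (y : Q.L) (ι κ : Q.E) :
    (∑ g : Q.G, ((g y : Q.L) : ℂ) • (Q.dzE ((g : Q.L →ₐ[ℚ] Q.L).comp ι) *
      Q.dzE ((g : Q.L →ₐ[ℚ] Q.L).comp κ))) ∈ Torus.rationalClasses Q.Λ 2 := by
  rw [sum_gal_eq_sum_trace]
  exact Torus.sum_mem_rationalClasses_two Q.rationalCovec_mem _

theorem orbitClass_rational (a : Q.L) : Q.orbitClass a ∈ Torus.rationalClasses Q.Λ 2 := by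
  have h := Torus.ratCast_smul_mem (1 / 4) (sum_gal_rational (a * (Q.rootL 0 - Q.rootL 2))
    (Q.φ 0) (Q.φ 2))
  have h4 : ((1 / 4 : ℚ) : ℂ) = 1 / 4 := by norm_num
  rw [h4] at h
  exact h

end MumfordQuartic

end

noncomputable section

/-! ### Two-forms in four variables -/

section Quaternary

variable {R : Type*} [Ring R] [Algebra ℂ R]

/-- The two-form with coefficients `p` in the pairwise products of `e`. -/
def quaternaryTwoForm (e : Fin 4 → R) (p : Fin 4 → Fin 4 → ℂ) : R :=
  p 0 1 • (e 0 * e 1) + p 0 2 • (e 0 * e 2) + p 0 3 • (e 0 * e 3) + p 1 2 • (e 1 * e 2) +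
    p 1 3 • (e 1 * e 3) + p 2 3 • (e 2 * e 3)

/-- Only products of complementary pairs survive, each occurring in both orders; with the reordering
signs this is twice the Pfaffian of p. -/
theorem quaternaryTwoForm_sq {e : Fin 4 → R} (hsq : ∀ i, e i * e i = 0)
    (hanti : ∀ i j, e i * e j = -(e j * e i)) (p : Fin 4 → Fin 4 → ℂ) :
    quaternaryTwoForm e p ^ 2 =
    (2 * (p 0 1 * p 2 3 - p 0 2 * p 1 3 + p 0 3 * p 1 2)) • (e 0 * e 1 * e 2 * e 3) := by
  have hz1 : ∀ i j k, e i * e j * (e i * e k) = 0 := fun i j k => by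
    rw [hanti i j, neg_mul, mul_assoc, ← mul_assoc (e i), hsq, zero_mul, mul_zero, neg_zero]
  have hz2 : ∀ i j k, e i * e j * (e j * e k) = 0 := fun i j k => by
    rw [mul_assoc, ← mul_assoc (e j), hsq, zero_mul, mul_zero]
  have hz3 : ∀ i j k, e i * e j * (e k * e j) = 0 := fun i j k => by
    rw [hanti k j, mul_neg, hz2, neg_zero]
  have hz4 : ∀ i j k, e i * e j * (e k * e i) = 0 := fun i j k => by
    rw [hanti k i, mul_neg, hz1, neg_zero]
  have hs : ∀ i j k l, e i * e j * (e k * e l) = -(e i * e k * (e j * e l)) := fun i j k l => by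
    rw [mul_assoc, ← mul_assoc (e j), hanti j k, neg_mul, mul_neg, mul_assoc, mul_assoc]
  have hr : ∀ i j k l, e i * e j * (e k * e l) = -(e i * e j * (e l * e k)) := fun i j k l => by
    rw [hanti k l, mul_neg]
  have hl : ∀ i j k l, e i * e j * (e k * e l) = -(e j * e i * (e k * e l)) := fun i j k l => by
    rw [hanti i j, neg_mul]
  have h1 : e 0 * e 2 * (e 1 * e 3) = -(e 0 * e 1 * (e 2 * e 3)) := hs _ _ _ _
  have h2 : e 0 * e 3 * (e 1 * e 2) = e 0 * e 1 * (e 2 * e 3) := by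
    rw [hs, hr, neg_neg]
  have h3 : e 1 * e 2 * (e 0 * e 3) = e 0 * e 1 * (e 2 * e 3) := by
    rw [hs, hl, neg_neg]
  have h4 : e 1 * e 3 * (e 0 * e 2) = -(e 0 * e 1 * (e 2 * e 3)) := by
    rw [hs, hl, neg_neg, hr]
  have h5 : e 2 * e 3 * (e 0 * e 1) = e 0 * e 1 * (e 2 * e 3) := by
    rw [hs, hl, neg_neg, hr, hs, neg_neg]
  rw [pow_two, mul_assoc (e 0 * e 1)]
  simp only [quaternaryTwoForm, mul_add, add_mul, smul_mul_smul_comm, hz1, hz2, hz3, hz4, h1, h2,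
    h3, h4, h5, smul_zero, add_zero, zero_add]
  module

/-- The square is a multiple of the top product, which every further factor `e i` annihilates. -/
theorem quaternaryTwoForm_cube {e : Fin 4 → R} (hsq : ∀ i, e i * e i = 0)
    (hanti : ∀ i j, e i * e j = -(e j * e i)) (p : Fin 4 → Fin 4 → ℂ) :
    quaternaryTwoForm e p ^ 3 = 0 := by
  have h0 : ∀ i, e 0 * e 1 * e 2 * e 3 * e i = 0 := by
    intro i
    have h3 : e 0 * e 1 * e 2 * e 3 * e 3 = 0 := by rw [mul_assoc, hsq, mul_zero]
    have h2 : e 0 * e 1 * e 2 * e 3 * e 2 = 0 := by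
      rw [mul_assoc, hanti 3 2, mul_neg, ← mul_assoc, mul_assoc (e 0 * e 1), hsq, mul_zero,
        zero_mul, neg_zero]
    have h1 : e 0 * e 1 * e 2 * e 1 = 0 := by
      rw [mul_assoc, hanti 2 1, mul_neg, ← mul_assoc, mul_assoc (e 0), hsq, mul_zero,
        zero_mul, neg_zero]
    have h1' : e 0 * e 1 * e 2 * e 3 * e 1 = 0 := by
      rw [mul_assoc, hanti 3 1, mul_neg, ← mul_assoc, h1, zero_mul, neg_zero]
    have h0 : e 0 * e 1 * e 0 = 0 := by
      rw [mul_assoc, hanti 1 0, mul_neg, ← mul_assoc, hsq, zero_mul, neg_zero]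
    have h0' : e 0 * e 1 * e 2 * e 0 = 0 := by
      rw [mul_assoc, hanti 2 0, mul_neg, ← mul_assoc, h0, zero_mul, neg_zero]
    have h0'' : e 0 * e 1 * e 2 * e 3 * e 0 = 0 := by
      rw [mul_assoc, hanti 3 0, mul_neg, ← mul_assoc, h0', zero_mul, neg_zero]
    fin_cases i
    · exact h0''
    · exact h1'
    · exact h2
    · exact h3
  rw [pow_succ, quaternaryTwoForm_sq hsq hanti]
  simp only [quaternaryTwoForm, mul_add, mul_smul_comm, smul_mul_assoc, ← mul_assoc _ (e _) (e _),
    h0, zero_mul, smul_zero, add_zero]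

end Quaternary

/-- Writes the 24 terms explicitly, so that an orbit sum becomes an identity in a module. -/
theorem sum_perm_fin_four {M : Type*} [AddCommMonoid M] (f : Fin 4 → Fin 4 → Fin 4 → Fin 4 → M) :
    ∑ σ : Equiv.Perm (Fin 4), f (σ 0) (σ 1) (σ 2) (σ 3) =
      (f 0 1 2 3 + f 0 1 3 2 + f 0 2 1 3 + f 0 2 3 1 + f 0 3 1 2 + f 0 3 2 1) +
      (f 1 0 2 3 + f 1 0 3 2 + f 1 2 0 3 + f 1 2 3 0 + f 1 3 0 2 + f 1 3 2 0) +
      (f 2 0 1 3 + f 2 0 3 1 + f 2 1 0 3 + f 2 1 3 0 + f 2 3 0 1 + f 2 3 1 0) +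
      (f 3 0 1 2 + f 3 0 2 1 + f 3 1 0 2 + f 3 1 2 0 + f 3 2 0 1 + f 3 2 1 0) := by
  have h : ∑ σ : Equiv.Perm (Fin 4), f (σ 0) (σ 1) (σ 2) (σ 3) =
      ∑ v ∈ Finset.univ.image (fun σ : Equiv.Perm (Fin 4) => (σ 0, σ 1, σ 2, σ 3)),
        f v.1 v.2.1 v.2.2.1 v.2.2.2 := by
    rw [Finset.sum_image]
    intro σ _ τ _ hστ
    simp only [Prod.mk.injEq] at hστ
    ext k
    fin_cases k
    · exact congrArg _ hστ.1
    · exact congrArg _ hστ.2.1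
    · exact congrArg _ hστ.2.2.1
    · exact congrArg _ hστ.2.2.2
  have himg : Finset.univ.image (fun σ : Equiv.Perm (Fin 4) => (σ 0, σ 1, σ 2, σ 3)) =
      {(0, 1, 2, 3), (0, 1, 3, 2), (0, 2, 1, 3), (0, 2, 3, 1), (0, 3, 1, 2), (0, 3, 2, 1),
       (1, 0, 2, 3), (1, 0, 3, 2), (1, 2, 0, 3), (1, 2, 3, 0), (1, 3, 0, 2), (1, 3, 2, 0),
       (2, 0, 1, 3), (2, 0, 3, 1), (2, 1, 0, 3), (2, 1, 3, 0), (2, 3, 0, 1), (2, 3, 1, 0),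
       (3, 0, 1, 2), (3, 0, 2, 1), (3, 1, 0, 2), (3, 1, 2, 0), (3, 2, 0, 1), (3, 2, 1, 0)} := by
    decide
  rw [h, himg]
  repeat rw [Finset.sum_insert (by decide)]
  rw [Finset.sum_singleton]
  simp only [add_assoc]

namespace Torus

variable {V : Type} [AddCommGroup V] [Module ℝ V]

theorem oneForm_mul_oneForm_commute (ξ η : Covector V) (b : InvForm V) :
    Commute (oneForm ξ * oneForm η) b := by
  induction b using ExteriorAlgebra.induction with
  | algebraMap r => exact (Algebra.commutes r _).symm
  | ι ζ =>
    have h : ∀ a b : Covector V, oneForm a * oneForm b = -(oneForm b * oneForm a) := fun a b =>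
      eq_neg_of_add_eq_zero_left (ExteriorAlgebra.ι_add_mul_swap a b)
    change oneForm ξ * oneForm η * oneForm ζ = oneForm ζ * (oneForm ξ * oneForm η)
    rw [mul_assoc, h η ζ, mul_neg, ← mul_assoc, h ξ ζ, neg_mul, neg_neg, mul_assoc]
  | mul a b ha hb => exact ha.mul_right hb
  | add a b ha hb => exact ha.add_right hb

end Torus

/-! ### The classes A₁ and A₂, face by face -/

namespace MumfordQuartic

variable (Q : MumfordQuartic)

/-- The one-forms `dz` of the embeddings that map `i𝔻` to `ε i𝔻`. -/
def faceForm (ε : ℤˣ) (j : Fin 4) : Torus.InvForm Q.V := Q.dzE (Q.emb j ε)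

theorem faceForm_sq (ε : ℤˣ) (i : Fin 4) : Q.faceForm ε i * Q.faceForm ε i = 0 :=
  ExteriorAlgebra.ι_sq_zero _

theorem dzE_anti (ι κ : Q.E) : Q.dzE ι * Q.dzE κ = -(Q.dzE κ * Q.dzE ι) :=
  eq_neg_of_add_eq_zero_left (ExteriorAlgebra.ι_add_mul_swap _ _)

theorem faceForm_anti (ε : ℤˣ) (i j : Fin 4) :
    Q.faceForm ε i * Q.faceForm ε j = -(Q.faceForm ε j * Q.faceForm ε i) := Q.dzE_anti _ _

/-- The coefficients `h_{jk} (x_j - x_k)`. -/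
def faceCoeff : Fin 4 → Fin 4 → ℂ := fun j k =>
  ((∑ l, Q.x l * (∑ m, Q.x m - Q.x l)) / 2 - (Q.x j + Q.x k) *
    (∑ m, Q.x m - Q.x j - Q.x k)) * (Q.x j - Q.x k)

/-- The part of `A₁` supported on one face of the cube. -/
def facePart (ε : ℤˣ) : Torus.InvForm Q.V := quaternaryTwoForm (Q.faceForm ε) Q.faceCoeff

/-- Complementary pairs share the same h, and the differences of the three values of h are the
products (x_j - x_k)(x_l - x_m). The Pfaffian is thus the Vandermonde product of the three h, which
multiplies out to 𝔻. -/
theorem facePart_sq (ε : ℤˣ) : Q.facePart ε ^ 2 =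
    (2 * Q.disc : ℂ) • (Q.faceForm ε 0 * Q.faceForm ε 1 * Q.faceForm ε 2 * Q.faceForm ε 3) := by
  rw [facePart, quaternaryTwoForm_sq (Q.faceForm_sq ε) (Q.faceForm_anti ε)]
  congr 2
  simp only [faceCoeff, disc, Fin.sum_univ_four]
  push_cast
  ring

theorem facePart_cube (ε : ℤˣ) : Q.facePart ε ^ 3 = 0 :=
  quaternaryTwoForm_cube (Q.faceForm_sq ε) (Q.faceForm_anti ε) _

theorem facePart_commute (ε : ℤˣ) (b : Torus.InvForm Q.V) : Commute (Q.facePart ε) b := by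
  have h : ∀ j k (p : ℂ), Commute (p • (Q.faceForm ε j * Q.faceForm ε k)) b := fun j k p =>
    (Torus.oneForm_mul_oneForm_commute _ _ b).smul_left p
  exact (((((h _ _ _).add_left (h _ _ _)).add_left (h _ _ _)).add_left (h _ _ _)).add_left
    (h _ _ _)).add_left (h _ _ _)

theorem M_eq : Q.M = (Q.disc : ℂ) •
    (Q.faceForm 1 0 * Q.faceForm 1 1 * Q.faceForm 1 2 * Q.faceForm 1 3 +
      Q.faceForm (-1) 0 * Q.faceForm (-1) 1 * Q.faceForm (-1) 2 * Q.faceForm (-1) 3) := by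
  simp [M, dz_eq, dzbar_eq, faceForm, pow_succ]

variable {Q}

theorem coe_galOf_face (σ : Equiv.Perm (Fin 4)) (ε : ℤˣ) :
    ((Q.galOf σ ε (Q.h₃ * (Q.rootL 0 - Q.rootL 2)) : Q.L) : ℂ) =
      (Q.x (σ 0) * Q.x (σ 2) + Q.x (σ 1) * Q.x (σ 3)) * (Q.x (σ 0) - Q.x (σ 2)) := by
  simp only [h₃, map_mul, map_add, map_sub, galOf_rootL]
  rfl

theorem orbitClass_eq {a : Q.L} (s : ℤˣ → ℂ)
    (ha : ∀ σ ε, ((Q.galOf σ ε a : Q.L) : ℂ) = s ε) :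
    Q.orbitClass (a * Q.h₃) = s 1 • Q.facePart 1 + s (-1) • Q.facePart (-1) := by
  have hφ0 : Q.φ 0 = Q.emb 0 1 := by rw [φ_eq_emb]; rfl
  have hφ2 : Q.φ 2 = Q.emb 2 1 := by rw [φ_eq_emb]; rfl
  -- Each pair {j, k} arises as {σ 0, σ 2} for four permutations. Exchanging j and k negates both
  -- the difference of roots and the product of forms, so the four terms agree; this cancels the
  -- 1/4.
  have hpart : ∀ ε, ∑ σ : Equiv.Perm (Fin 4),
      (((Q.x (σ 0) * Q.x (σ 2) + Q.x (σ 1) * Q.x (σ 3)) * (Q.x (σ 0) - Q.x (σ 2)) : ℂ)) •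
        (Q.faceForm ε (σ 0) * Q.faceForm ε (σ 2)) = (4 : ℂ) • Q.facePart ε := by
    intro ε
    rw [sum_perm_fin_four fun i j k l =>
      (((Q.x i * Q.x k + Q.x j * Q.x l) * (Q.x i - Q.x k) : ℂ)) •
        (Q.faceForm ε i * Q.faceForm ε k)]
    rw [Q.faceForm_anti ε 1 0, Q.faceForm_anti ε 2 0, Q.faceForm_anti ε 3 0,
      Q.faceForm_anti ε 2 1, Q.faceForm_anti ε 3 1, Q.faceForm_anti ε 3 2]
    -- `faceCoeff` writes h_{jk} as e₂ - (x_j + x_k)(x_l + x_m), with e₂ the second elementary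
    -- symmetric function, so as not to name the complementary pair.
    simp only [facePart, quaternaryTwoForm, faceCoeff, Fin.sum_univ_four]
    module
  have hterm : ∀ σ ε, ((Q.galOf σ ε (a * Q.h₃ * (Q.rootL 0 - Q.rootL 2)) : Q.L) : ℂ) •
      (Q.dzE ((Q.galOf σ ε : Q.L →ₐ[ℚ] Q.L).comp (Q.φ 0)) *
        Q.dzE ((Q.galOf σ ε : Q.L →ₐ[ℚ] Q.L).comp (Q.φ 2))) =
      s ε • ((((Q.x (σ 0) * Q.x (σ 2) + Q.x (σ 1) * Q.x (σ 3)) * (Q.x (σ 0) - Q.x (σ 2)) : ℂ)) •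
        (Q.faceForm ε (σ 0) * Q.faceForm ε (σ 2))) := by
    intro σ ε
    have h1 : ((Q.galOf σ ε (a * Q.h₃ * (Q.rootL 0 - Q.rootL 2)) : Q.L) : ℂ) =
        s ε * ((Q.x (σ 0) * Q.x (σ 2) + Q.x (σ 1) * Q.x (σ 3)) * (Q.x (σ 0) - Q.x (σ 2))) := by
      rw [mul_assoc, map_mul, ← ha σ ε, ← coe_galOf_face σ ε]
      rfl
    rw [hφ0, hφ2, gal_comp_emb, gal_comp_emb, one_mul, h1, mul_smul]
    rfl
  rw [orbitClass, ← (Equiv.ofBijective _ Q.galOf_bijective).sum_comp, Fintype.sum_prod_type,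
    Finset.sum_comm]
  simp only [Equiv.ofBijective_apply, hterm, ← Finset.smul_sum, hpart]
  rw [show (Finset.univ : Finset ℤˣ) = {1, -1} from rfl, Finset.sum_pair (by decide)]
  module

theorem A₁_eq : Q.A₁ = Q.facePart 1 + Q.facePart (-1) := by
  have h := orbitClass_eq (Q := Q) (a := 1) (fun _ => 1) fun σ ε => by rw [map_one]; rfl
  rw [one_mul, one_smul, one_smul] at h
  exact h

theorem A₂_eq (c : ℤ) : Q.A₂ c =
    (Complex.I * c * Q.disc : ℂ) • (Q.facePart 1 - Q.facePart (-1)) := by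
  have h := orbitClass_eq (Q := Q) (a := Q.imL * c * Q.discL)
    (fun ε => Complex.I * c * Q.disc * ((ε : ℤ) : ℂ)) fun σ ε => by
      have h1 : Q.galOf σ ε (Q.imL * c * Q.discL) =
          (c : Q.L) * (((ε : ℤ) : Q.L) * (Q.imL * Q.discL)) := by
        rw [← galOf_imDisc, show Q.imL * c * Q.discL = c * (Q.imL * Q.discL) by ring, map_mul,
          map_intCast]
      have h2 : (((c : Q.L) * (((ε : ℤ) : Q.L) * (Q.imL * Q.discL)) : Q.L) : ℂ) =
          (c : ℂ) * (((ε : ℤ) : ℂ) * (Complex.I * (Q.discL : ℂ))) := rfl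
      rw [h1, h2, coe_discL]
      ring
  rw [A₂, h]
  simp only [Units.val_one, Units.val_neg, Int.cast_one, Int.cast_neg]
  module

theorem A₁_commute (b : Torus.InvForm Q.V) : Commute Q.A₁ b := by
  rw [A₁_eq]
  exact (Q.facePart_commute 1 b).add_left (Q.facePart_commute (-1) b)

theorem A₂_commute (c : ℤ) (b : Torus.InvForm Q.V) : Commute (Q.A₂ c) b := by
  rw [A₂_eq]
  exact ((Q.facePart_commute 1 b).sub_left (Q.facePart_commute (-1) b)).smul_left _

/-- In the binomial expansion of a fifth power, one of the two commuting face parts always has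
exponent at least three. -/
theorem A₁_pow_five : Q.A₁ ^ 5 = 0 := by
  rw [A₁_eq]
  exact (Q.facePart_commute 1 _).add_pow_eq_zero_of_add_le_succ_of_pow_eq_zero
    (Q.facePart_cube 1) (Q.facePart_cube (-1)) (by norm_num)

theorem A₂_pow_five (c : ℤ) : Q.A₂ c ^ 5 = 0 := by
  rw [A₂_eq, smul_pow, sub_eq_add_neg,
    (Q.facePart_commute 1 _).add_pow_eq_zero_of_add_le_succ_of_pow_eq_zero
      (Q.facePart_cube 1) (by rw [neg_pow, Q.facePart_cube, mul_zero]) (by norm_num), smul_zero]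

/-- The scalar of A₂ squares to -c²Δ, so -A₂² adds c²Δ(f₊ - f₋)². The cross terms cancel against
those of c²Δ A₁² and the squares of the face parts double. -/
theorem A₁_sq_sub_A₂_sq {Δ : ℕ} (hΔ : Q.disc ^ 2 = Δ) (c : ℤ) :
    (c ^ 2 * Δ : ℂ) • Q.A₁ ^ 2 - Q.A₂ c ^ 2 = (4 * c ^ 2 * Δ : ℂ) • Q.M := by
  have hΔ' : (Q.disc : ℂ) ^ 2 = Δ := by exact_mod_cast congrArg (fun r : ℝ => (r : ℂ)) hΔ
  have h1 : (Q.facePart 1 + Q.facePart (-1)) ^ 2 = Q.facePart 1 ^ 2 +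
      (2 : ℂ) • (Q.facePart 1 * Q.facePart (-1)) + Q.facePart (-1) ^ 2 := by
    rw [(Q.facePart_commute 1 (Q.facePart (-1))).add_sq, two_smul, mul_assoc, two_mul]
  have h2 : (Q.facePart 1 - Q.facePart (-1)) ^ 2 = Q.facePart 1 ^ 2 -
      (2 : ℂ) • (Q.facePart 1 * Q.facePart (-1)) + Q.facePart (-1) ^ 2 := by
    rw [(Q.facePart_commute 1 (Q.facePart (-1))).sub_sq, two_smul, mul_assoc, two_mul]
  have hs : (Complex.I * c * Q.disc : ℂ) ^ 2 = -(c ^ 2 * Δ) := by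
    rw [mul_pow, mul_pow, Complex.I_sq, hΔ']
    ring
  rw [A₁_eq, A₂_eq, smul_pow, h1, h2, hs, facePart_sq, facePart_sq, M_eq]
  module

end MumfordQuartic

end

/-! ### The Chern character of the virtual bundle -/

noncomputable section

namespace Torus

section

variable {V : Type} [NormedAddCommGroup V] [NormedSpace ℝ V]
  {Λ : AddSubgroup V}

/-- Odd powers cancel and even ones double, as for 2 cosh; nilpotency makes the cut-off n irrelevant
once it is at least 4. -/
theorem sum_exp_add_sum_exp_neg {A : InvForm V} (hA : A ^ 5 = 0) {n : ℕ} (hn : 4 ≤ n) :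
    (∑ k ∈ Finset.range (n + 1), ((k.factorial : ℂ)⁻¹) • A ^ k) +
      (∑ k ∈ Finset.range (n + 1), ((k.factorial : ℂ)⁻¹) • (-A) ^ k) =
    (2 : ℂ) • 1 + A ^ 2 + (1 / 12 : ℂ) • A ^ 4 := by
  have htrunc : ∀ B : InvForm V, B ^ 5 = 0 →
      ∑ k ∈ Finset.range (n + 1), ((k.factorial : ℂ)⁻¹) • B ^ k =
        ∑ k ∈ Finset.range 5, ((k.factorial : ℂ)⁻¹) • B ^ k := by
    intro B hB
    symm
    refine Finset.sum_subset (Finset.range_subset_range.mpr (by omega)) fun k _ hk => ?_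
    rw [pow_eq_zero_of_le (by simpa using hk) hB, smul_zero]
  rw [htrunc A hA, htrunc (-A) (by rw [Odd.neg_pow (by decide), hA, neg_zero])]
  simp only [Finset.sum_range_succ, Finset.sum_range_zero, pow_zero, pow_one,
    Even.neg_pow (show Even 2 by decide), Odd.neg_pow (show Odd 3 by decide),
    Even.neg_pow (show Even 4 by decide), Nat.factorial]
  norm_num
  module

open SmoothBundle in
/-- The Chern character of `L ⊕ L⁻¹` is `2 cosh c₁(L)`. -/
theorem SmoothBundle.HasFirstChernClass.hasChernCharacter_directSum_dual
    [FiniteDimensional ℝ V] {L : LineBundle Λ}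
    {A : InvForm V} (hcomm : ∀ b, Commute A b) (hA : A ^ 5 = 0) (hV : 4 ≤ Module.finrank ℝ V)
    (h : L.HasFirstChernClass A) : (L.directSum L.dual).HasChernCharacter
      ((2 : ℂ) • 1 + A ^ 2 + (1 / 12 : ℂ) • A ^ 4) := by
  have h1 := (h.hasChernCharacter hcomm).directSum
    (h.dual.hasChernCharacter fun b => (hcomm b).neg_left)
  rwa [sum_exp_add_sum_exp_neg hA hV] at h1

theorem one_mem_rationalClasses_zero : (1 : InvForm V) ∈ rationalClasses Λ 0 := by
  rw [rationalClasses, pow_zero]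
  exact Submodule.one_le.mp le_rfl

open SmoothBundle in
/-- The Chern character of `N (L₁ ⊕ L₁⁻¹) ⊖ (L₂ ⊕ L₂⁻¹)` in degrees up to eight. -/
theorem exists_hasVirtualChernCharacter [FiniteDimensional ℝ V] {L₁ L₂ : LineBundle Λ}
    {A₁ A₂ η : InvForm V} (hcomm₁ : ∀ b, Commute A₁ b) (hcomm₂ : ∀ b, Commute A₂ b)
    (hA₁ : A₁ ^ 5 = 0) (hA₂ : A₂ ^ 5 = 0) (hr₁ : A₁ ∈ rationalClasses Λ 2)
    (hr₂ : A₂ ∈ rationalClasses Λ 2) (hV : 4 ≤ Module.finrank ℝ V)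
    (h₁ : L₁.HasFirstChernClass A₁) (h₂ : L₂.HasFirstChernClass A₂) {N : ℕ}
    (h : (N : ℂ) • A₁ ^ 2 - A₂ ^ 2 = η) :
    ∃ r₀ ∈ rationalClasses Λ 0, ∃ r₈ ∈ rationalClasses Λ 8,
      ((L₁.directSum L₁.dual).copies N).HasVirtualChernCharacter (L₂.directSum L₂.dual)
        (η + r₀ + r₈) := by
  -- These are the constant term N · 2 - 2 and the difference of the quartic terms 2A⁴/4! = A⁴/12.
  refine ⟨((2 * (N - 1) : ℚ) : ℂ) • 1, ratCast_smul_mem _ one_mem_rationalClasses_zero,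
    ((1 / 12 : ℚ) : ℂ) • (((N : ℚ) : ℂ) • A₁ ^ 4 - A₂ ^ 4),
    ratCast_smul_mem _ (Submodule.sub_mem _
      (ratCast_smul_mem _ (pow_mem_rationalClasses hr₁ 4)) (pow_mem_rationalClasses hr₂ 4)),
    _, _, (h₁.hasChernCharacter_directSum_dual hcomm₁ hA₁ hV).copies N,
    h₂.hasChernCharacter_directSum_dual hcomm₂ hA₂ hV, ?_⟩
  rw [← h]
  push_cast
  module

end

end Torus

/-! ### M is a rational (2,2)-class that is not generated by divisor classes -/

namespace MumfordQuartic

variable {Q : MumfordQuartic}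

theorem disc_nat_ne_zero {Δ : ℕ} (hΔ : Q.disc ^ 2 = Δ) : (Δ : ℚ) ≠ 0 := by
  have h : (Δ : ℝ) ≠ 0 := by
    rw [← hΔ]
    exact pow_ne_zero 2 Q.disc_pos.ne'
  exact_mod_cast h

/-- With c = 1 the quadratic identity expresses M as (Δ A₁² - A₂²)/(4Δ), and 𝔻 > 0 makes Δ
invertible. -/
theorem M_rational {Δ : ℕ} (hΔ : Q.disc ^ 2 = Δ) : Q.M ∈ Torus.rationalClasses Q.Λ 4 := by
  have h := A₁_sq_sub_A₂_sq hΔ 1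
  have h1 : Q.A₁ ^ 2 ∈ Torus.rationalClasses Q.Λ 4 :=
    Torus.pow_mem_rationalClasses (Q.orbitClass_rational _) 2
  have h2 : Q.A₂ 1 ^ 2 ∈ Torus.rationalClasses Q.Λ 4 :=
    Torus.pow_mem_rationalClasses (Q.orbitClass_rational _) 2
  have h3 := Torus.ratCast_smul_mem ((4 * (Δ : ℚ))⁻¹)
    (Submodule.sub_mem _ (Torus.ratCast_smul_mem (Δ : ℚ) h1) h2)
  have h4 : (Δ : ℂ) ≠ 0 := by exact_mod_cast disc_nat_ne_zero hΔ
  have h5 : ((1 : ℤ) ^ 2 * Δ : ℂ) = ((Δ : ℚ) : ℂ) := by push_cast; ring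
  rw [h5] at h
  rw [h, smul_smul] at h3
  have h6 : (((4 * (Δ : ℚ))⁻¹ : ℚ) : ℂ) * (4 * (1 : ℤ) ^ 2 * Δ) = 1 := by
    push_cast
    field_simp
  rw [h6, one_smul] at h3
  exact h3

theorem dzbar_anti_dz (j k : Fin 4) : Q.dzbar j * Q.dz k = -(Q.dz k * Q.dzbar j) :=
  eq_neg_of_add_eq_zero_left (ExteriorAlgebra.ι_add_mul_swap _ _)

theorem M_mem_hodge : Q.M ∈ Q.hodge 2 2 := by
  have hz : ∀ j k, Q.dz j * Q.dz k ∈ Submodule.span ℂ (Set.range Q.dz) ^ 2 := fun j k => by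
    rw [pow_two]
    exact Submodule.mul_mem_mul (Submodule.subset_span ⟨j, rfl⟩) (Submodule.subset_span ⟨k, rfl⟩)
  have hzb : ∀ j k, Q.dzbar j * Q.dzbar k ∈ Submodule.span ℂ (Set.range Q.dzbar) ^ 2 :=
    fun j k => by
      rw [pow_two]
      exact Submodule.mul_mem_mul (Submodule.subset_span ⟨j, rfl⟩)
        (Submodule.subset_span ⟨k, rfl⟩)
  have h1 : Q.dz 0 * Q.dzbar 1 * Q.dz 2 * Q.dzbar 3 =
      -((Q.dz 0 * Q.dz 2) * (Q.dzbar 1 * Q.dzbar 3)) := by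
    rw [mul_assoc (Q.dz 0), dzbar_anti_dz]
    noncomm_ring
  have h2 : Q.dzbar 0 * Q.dz 1 * Q.dzbar 2 * Q.dz 3 =
      -((Q.dz 1 * Q.dz 3) * (Q.dzbar 0 * Q.dzbar 2)) := by
    have h3 : Q.dzbar 0 * Q.dz 1 * Q.dzbar 2 * Q.dz 3 =
        -(Q.dz 1 * (Q.dzbar 0 * (Q.dzbar 2 * Q.dz 3))) := by
      rw [dzbar_anti_dz]
      noncomm_ring
    rw [h3, dzbar_anti_dz, mul_neg, ← mul_assoc (Q.dzbar 0), dzbar_anti_dz]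
    noncomm_ring
  rw [M, h1, h2]
  exact Submodule.smul_mem _ _ (Submodule.add_mem _
    (Submodule.neg_mem _ (Submodule.mul_mem_mul (hz _ _) (hzb _ _)))
    (Submodule.neg_mem _ (Submodule.mul_mem_mul (hz _ _) (hzb _ _))))

/-- The rational two-classes have equivariant coefficients in `L`. -/
theorem exists_equivariant_of_mem_rationalClasses_two {η : Torus.InvForm Q.V}
    (hη : η ∈ Torus.rationalClasses Q.Λ 2) : ∃ c : Q.E → Q.E → Q.L,
      (∀ (g : Q.G) ι κ, c ((g : Q.L →ₐ[ℚ] Q.L).comp ι) ((g : Q.L →ₐ[ℚ] Q.L).comp κ) =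
        g (c ι κ)) ∧ η = ∑ ι, ∑ κ, ((c ι κ : Q.L) : ℂ) • (Q.dzE ι * Q.dzE κ) := by
  have h1 : ∀ η ∈ Submodule.span ℚ
      (Torus.oneForm '' {ξ : Torus.Covector Q.V | ∀ v ∈ Q.Λ, ∃ q : ℚ, ξ v = q}),
      ∃ c : Q.E → Q.L, (∀ (g : Q.G) ι, c ((g : Q.L →ₐ[ℚ] Q.L).comp ι) = g (c ι)) ∧
        η = ∑ ι, ((c ι : Q.L) : ℂ) • Q.dzE ι := by
    intro η hη
    induction hη using Submodule.span_induction with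
    | mem x hx =>
      obtain ⟨ξ, hξ, rfl⟩ := hx
      obtain ⟨c, hc, h⟩ := exists_equivariant_of_rational hξ
      refine ⟨c, hc, ?_⟩
      conv_lhs => rw [h]
      simp only [map_sum, map_smul, dzE_eq]
    | zero =>
      refine ⟨0, fun g ι => (map_zero g).symm, ?_⟩
      exact (Finset.sum_eq_zero fun ι _ => zero_smul ℂ _).symm
    | add x y _ _ hx hy =>
      obtain ⟨c, hc, rfl⟩ := hx
      obtain ⟨d, hd, rfl⟩ := hy
      refine ⟨c + d, fun g ι => by simp only [Pi.add_apply, hc, hd, map_add], ?_⟩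
      rw [← Finset.sum_add_distrib]
      exact Finset.sum_congr rfl fun ι _ => (add_smul _ _ _).symm
    | smul q x _ hx =>
      obtain ⟨c, hc, rfl⟩ := hx
      refine ⟨fun ι => algebraMap ℚ Q.L q * c ι, fun g ι => by
        simp only [hc, map_mul, AlgEquiv.commutes], ?_⟩
      rw [← Rat.cast_smul_eq_qsmul ℂ, Finset.smul_sum]
      exact Finset.sum_congr rfl fun ι _ => smul_smul _ _ _
  rw [Torus.rationalClasses, pow_two] at hη
  induction hη using Submodule.mul_induction_on' with
  | mem_mul_mem x hx y hy =>
    obtain ⟨c, hc, rfl⟩ := h1 x hx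
    obtain ⟨d, hd, rfl⟩ := h1 y hy
    refine ⟨fun ι κ => c ι * d κ, fun g ι κ => by simp only [hc, hd, map_mul], ?_⟩
    rw [Finset.sum_mul_sum]
    exact Finset.sum_congr rfl fun ι _ => Finset.sum_congr rfl fun κ _ =>
      smul_mul_smul_comm _ _ _ _
  | add x _ y _ hx hy =>
    obtain ⟨c, hc, rfl⟩ := hx
    obtain ⟨d, hd, rfl⟩ := hy
    refine ⟨c + d, fun g ι κ => by simp only [Pi.add_apply, hc, hd, map_add], ?_⟩
    simp only [← Finset.sum_add_distrib]
    exact Finset.sum_congr rfl fun ι _ => Finset.sum_congr rfl fun κ _ => (add_smul _ _ _).symm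

/-- The homomorphism from the invariant forms to the exterior algebra of `ℂⁿ` that keeps the
coordinates with respect to the embeddings `s`. -/
def projAlg {n : ℕ} (s : Fin n → Q.E) :
    Torus.InvForm Q.V →ₐ[ℂ] ExteriorAlgebra ℂ (Fin n → ℂ) :=
  ExteriorAlgebra.map (LinearMap.pi fun i => coord (s i))

theorem projAlg_dzE_of_notMem {Δ : ℕ} (hΔ : Q.disc ^ 2 = Δ) {n : ℕ} {s : Fin n → Q.E} {ι : Q.E}
    (h : ∀ i, ι ≠ s i) : projAlg s (Q.dzE ι) = 0 := by
  rw [dzE_eq, projAlg, ExteriorAlgebra.map_apply_ι]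
  have : (LinearMap.pi fun i => coord (s i)) (Q.covec ι) = 0 :=
    funext fun i => by
      rw [LinearMap.pi_apply, coord_covec hΔ, if_neg (h i), Pi.zero_apply]
  rw [this, map_zero]

theorem projAlg_dzE {Δ : ℕ} (hΔ : Q.disc ^ 2 = Δ) {n : ℕ} {s : Fin n → Q.E}
    (hs : Function.Injective s) (i : Fin n) :
    projAlg s (Q.dzE (s i)) = ExteriorAlgebra.ι ℂ (Pi.single i 1) := by
  classical
  rw [dzE_eq, projAlg, ExteriorAlgebra.map_apply_ι]
  congr 1
  funext j
  rw [LinearMap.pi_apply, coord_covec hΔ, Pi.single_apply]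
  exact if_congr ⟨fun h => (hs h).symm, fun h => congrArg s h.symm⟩ rfl rfl

/-- The determinant, extended by zero in the other degrees, is a functional with value 1 on this
element. -/
theorem ιMulti_single_ne_zero (n : ℕ) :
    ExteriorAlgebra.ιMulti ℂ n (fun i : Fin n => (Pi.single i 1 : Fin n → ℂ)) ≠ 0 := by
  classical
  intro h
  let f : (i : ℕ) → (Fin n → ℂ) [⋀^Fin i]→ₗ[ℂ] ℂ := fun i =>
    if hi : i = n then hi ▸ Matrix.detRowAlternating else 0
  have h1 := ExteriorAlgebra.liftAlternating_apply_ιMulti f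
    (fun i : Fin n => (Pi.single i 1 : Fin n → ℂ))
  rw [h, map_zero] at h1
  have h2 : f n = Matrix.detRowAlternating := by simp [f]
  rw [h2] at h1
  have h3 : Matrix.detRowAlternating (fun i : Fin n => (Pi.single i 1 : Fin n → ℂ)) =
      (1 : Matrix (Fin n) (Fin n) ℂ).det := by
    refine congrArg Matrix.det (Matrix.ext fun i j => ?_)
    simp [Matrix.one_apply, Pi.single_apply, eq_comm]
  rw [h3, Matrix.det_one] at h1
  exact zero_ne_one h1

theorem projAlg_sum {Δ : ℕ} (hΔ : Q.disc ^ 2 = Δ) {n : ℕ} {s : Fin n → Q.E}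
    (hs : Function.Injective s) (c : Q.E → Q.E → ℂ) :
    projAlg s (∑ ι, ∑ κ, c ι κ • (Q.dzE ι * Q.dzE κ)) =
      ∑ i, ∑ j, c (s i) (s j) •
        (ExteriorAlgebra.ι ℂ (Pi.single i 1 : Fin n → ℂ) *
          ExteriorAlgebra.ι ℂ (Pi.single j 1)) := by
  have hzero : ∀ ι ∉ Set.range s, projAlg s (Q.dzE ι) = 0 := fun ι h =>
    projAlg_dzE_of_notMem hΔ fun i hi => h ⟨i, hi.symm⟩
  simp only [map_sum, map_smul, map_mul]
  symm
  refine Fintype.sum_of_injective s hs _ _ (fun ι h => ?_) fun i => ?_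
  · exact Finset.sum_eq_zero fun κ _ => by rw [hzero ι h, zero_mul, smul_zero]
  · refine Fintype.sum_of_injective s hs _ _ (fun κ h => ?_) fun j => ?_
    · rw [hzero κ h, mul_zero, smul_zero]
    · rw [projAlg_dzE hΔ hs, projAlg_dzE hΔ hs]

theorem exists_perm_zero_two : ∀ j k : Fin 4, j ≠ k →
    ∃ σ : Equiv.Perm (Fin 4), σ 0 = j ∧ σ 2 = k := by
  decide

/-- If no antiholomorphic embedding is retained, the projection kills every `dzbar`, and each
(1,1)-product contains one. -/
theorem projAlg_eq_zero_of_mem_hodge {Δ : ℕ} (hΔ : Q.disc ^ 2 = Δ) {n : ℕ} {s : Fin n → Q.E}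
    (hs : ∀ i l, s i ≠ Q.emb l (-(-1) ^ (l : ℕ))) {η : Torus.InvForm Q.V}
    (hη : η ∈ Q.hodge 1 1) : projAlg s η = 0 := by
  have hbar : Submodule.span ℂ (Set.range Q.dzbar) ≤ (projAlg s).toLinearMap.ker :=
    Submodule.span_le.mpr (by
      rintro _ ⟨l, rfl⟩
      change projAlg s (Q.dzbar l) = 0
      rw [dzbar_eq]
      exact projAlg_dzE_of_notMem hΔ fun i => (hs i l).symm)
  rw [hodge, pow_one, pow_one] at hη
  induction hη using Submodule.mul_induction_on' with
  | mem_mul_mem x _ y hy =>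
    have hy0 : projAlg s y = 0 := hbar hy
    rw [map_mul, hy0, mul_zero]
  | add x _ y _ hx hy => rw [map_add, hx, hy, add_zero]

/-- The coefficients of a rational `(1,1)`-class at two embeddings of the same face are
symmetric. -/
theorem coeff_symm {Δ : ℕ} (hΔ : Q.disc ^ 2 = Δ) {c : Q.E → Q.E → Q.L}
    (hc : ∀ (g : Q.G) ι κ, c ((g : Q.L →ₐ[ℚ] Q.L).comp ι) ((g : Q.L →ₐ[ℚ] Q.L).comp κ) =
        g (c ι κ))
    (h : ∑ ι, ∑ κ, ((c ι κ : Q.L) : ℂ) • (Q.dzE ι * Q.dzE κ) ∈ Q.hodge 1 1)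
    (j k : Fin 4) : c (Q.emb j 1) (Q.emb k 1) = c (Q.emb k 1) (Q.emb j 1) := by
  let s : Fin 2 → Q.E := fun i => Q.emb (![0, 2] i) 1
  have hs : Function.Injective s := fun a b hab =>
    (show Function.Injective ![(0 : Fin 4), 2] by decide) (Q.emb_injective hab).1
  -- The indices 0 and 2 are even, so with sign 1 both embeddings are holomorphic: the projection to
  -- them sees only the (2,0)-part.
  have hbar : ∀ i l, s i ≠ Q.emb l (-(-1) ^ (l : ℕ)) := by
    have hdec : ∀ (i : Fin 2) (l : Fin 4), ![0, 2] i = l → (1 : ℤˣ) ≠ -(-1) ^ (l : ℕ) := by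
      decide
    exact fun i l hil => hdec i l (Q.emb_injective hil).1 (Q.emb_injective hil).2
  have hproj := projAlg_eq_zero_of_mem_hodge hΔ hbar h
  have hne := ιMulti_single_ne_zero 2
  rw [projAlg_sum hΔ hs fun ι κ => ((c ι κ : Q.L) : ℂ)] at hproj
  simp only [Fin.sum_univ_two, ExteriorAlgebra.ι_sq_zero, smul_zero, zero_add, add_zero] at hproj
  rw [eq_neg_of_add_eq_zero_left (ExteriorAlgebra.ι_add_mul_swap 
    (Pi.single 1 1 : Fin 2 → ℂ) (Pi.single 0 1)), smul_neg, ← sub_eq_add_neg, ← sub_smul] at hproj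
  have hprod : ExteriorAlgebra.ι ℂ (Pi.single 0 1 : Fin 2 → ℂ) *
      ExteriorAlgebra.ι ℂ (Pi.single 1 1) ≠ 0 := by
    intro h0
    apply hne
    rw [ExteriorAlgebra.ιMulti_apply]
    simpa [List.ofFn_succ] using h0
  have h02 : c (Q.emb 0 1) (Q.emb 2 1) = c (Q.emb 2 1) (Q.emb 0 1) :=
    Subtype.val_injective (sub_eq_zero.mp ((smul_eq_zero.mp hproj).resolve_right hprod))
  by_cases hjk : j = k
  · rw [hjk]
  -- S₄ is doubly transitive, and G realises it within the face, so equivariance carries the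
  -- symmetry from the pair (0, 2) to (j, k).
  · obtain ⟨σ, rfl, rfl⟩ := exists_perm_zero_two j k hjk
    have hg : ∀ l, Q.emb (σ l) 1 =
        (Q.galOf σ 1 : Q.L →ₐ[ℚ] Q.L).comp (Q.emb l 1) := fun l => by
      rw [gal_comp_emb, mul_one]
    rw [hg, hg, hc, hc, h02]

/-- Symmetric coefficients against anticommuting products sum to zero. The face mixes holomorphic
and antiholomorphic embeddings, so the Hodge type alone would not suffice: the Galois action is
essential. -/
theorem projAlg_face_eq_zero {Δ : ℕ} (hΔ : Q.disc ^ 2 = Δ) {η : Torus.InvForm Q.V}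
    (hη : η ∈ Q.rationalHodge 1) : projAlg (fun j => Q.emb j 1) η = 0 := by
  obtain ⟨c, hc, rfl⟩ := exists_equivariant_of_mem_rationalClasses_two hη.1
  have hsymm := coeff_symm hΔ hc hη.2
  rw [projAlg_sum hΔ (fun j k h => (Q.emb_injective h).1) fun ι κ => ((c ι κ : Q.L) : ℂ)]
  set S := ∑ i, ∑ j, ((c (Q.emb i 1) (Q.emb j 1) : Q.L) : ℂ) •
    (ExteriorAlgebra.ι ℂ (Pi.single i 1 : Fin 4 → ℂ) *
      ExteriorAlgebra.ι ℂ (Pi.single j 1)) with hS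
  have h : S = -S := by
    conv_lhs => rw [hS, Finset.sum_comm]
    rw [hS]
    simp only [← Finset.sum_neg_distrib]
    refine Finset.sum_congr rfl fun i _ => Finset.sum_congr rfl fun j _ => ?_
    rw [hsymm j i, ← smul_neg]
    congr 1
    exact eq_neg_of_add_eq_zero_left (ExteriorAlgebra.ι_add_mul_swap _ _)
  have h2 : (2 : ℂ) • S = 0 := by
    rw [two_smul]
    exact eq_neg_iff_add_eq_zero.mp h
  exact (smul_eq_zero.mp h2).resolve_left two_ne_zero

/-- Projection to the face ε = 1 is multiplicative, so it kills all products of rational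
(1,1)-classes; but it sends M to 𝔻 times a nonzero top form. -/
theorem M_notMem {Δ : ℕ} (hΔ : Q.disc ^ 2 = Δ) : Q.M ∉ Q.rationalHodge 1 * Q.rationalHodge 1 := by
  intro hM
  have h0 : ∀ η ∈ Q.rationalHodge 1 * Q.rationalHodge 1,
      projAlg (fun j => Q.emb j 1) η = 0 := by
    intro η hη
    induction hη using Submodule.mul_induction_on' with
    | mem_mul_mem x hx y _ => rw [map_mul, projAlg_face_eq_zero hΔ hx, zero_mul]
    | add x _ y _ hx hy => rw [map_add, hx, hy, add_zero]
  have h1 := h0 _ hM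
  have hinj : Function.Injective fun j => Q.emb j 1 := fun j k h => (Q.emb_injective h).1
  have hp : ∀ j, projAlg (fun j => Q.emb j 1) (Q.faceForm 1 j) =
      ExteriorAlgebra.ι ℂ (Pi.single j 1) := projAlg_dzE hΔ hinj
  have hm : ∀ j, projAlg (fun j => Q.emb j 1) (Q.faceForm (-1) j) = 0 := fun j =>
    projAlg_dzE_of_notMem hΔ fun k hk => absurd (Q.emb_injective hk).2 (by decide)
  rw [M_eq, map_smul, map_add] at h1
  simp only [map_mul, hp, hm, mul_zero, add_zero] at h1
  rcases smul_eq_zero.mp h1 with h | h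
  · exact Q.disc_pos.ne' (Complex.ofReal_injective h)
  · apply ιMulti_single_ne_zero 4
    rw [ExteriorAlgebra.ιMulti_apply]
    simpa [← mul_assoc] using h

end MumfordQuartic

end

set_option maxHeartbeats 4000000 in
theorem mainTheorem1 (Q : MumfordQuartic) (Δ : ℕ) (hΔ : Q.disc ^ 2 = Δ) (c : ℤ)
    (hA₁ : Q.A₁ ∈ Torus.integralClasses Q.Λ 2) (hA₂ : Q.A₂ c ∈ Torus.integralClasses Q.Λ 2)
    (L₁ L₂ : Torus.LineBundle Q.Λ)
    (hL₁ : L₁.HasFirstChernClass Q.A₁) (hL₂ : L₂.HasFirstChernClass (Q.A₂ c)) :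
    (∃ r₀ ∈ Torus.rationalClasses Q.Λ 0, ∃ r₈ ∈ Torus.rationalClasses Q.Λ 8,
      ((L₁.directSum L₁.dual).copies (c.natAbs ^ 2 * Δ)).HasVirtualChernCharacter
        (L₂.directSum L₂.dual) ((4 * c ^ 2 * Δ : ℂ) • Q.M + r₀ + r₈)) ∧
    Q.M ∈ Q.rationalHodge 2 ∧ Q.M ∉ Q.rationalHodge 1 * Q.rationalHodge 1 := by
  refine ⟨?_, ⟨MumfordQuartic.M_rational hΔ, MumfordQuartic.M_mem_hodge⟩,
    MumfordQuartic.M_notMem hΔ⟩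
  -- The number of copies must be a natural number, whence |c|² in place of c².
  have hN : ((c.natAbs ^ 2 * Δ : ℕ) : ℂ) = c ^ 2 * Δ := by
    have h : ((c.natAbs : ℤ) : ℂ) ^ 2 = c ^ 2 := by
      rw [← Int.cast_pow, Int.natAbs_sq, Int.cast_pow]
    rw [Nat.cast_mul, Nat.cast_pow, ← h, Int.cast_natCast]
  have h := MumfordQuartic.A₁_sq_sub_A₂_sq hΔ c
  rw [← hN] at h
  exact Torus.exists_hasVirtualChernCharacter (V := Q.V) (A₁ := Q.A₁) (A₂ := Q.A₂ c)
    (η := (4 * c ^ 2 * Δ : ℂ) • Q.M) (MumfordQuartic.A₁_commute (Q := Q))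
    (MumfordQuartic.A₂_commute (Q := Q) c) (MumfordQuartic.A₁_pow_five (Q := Q))
    (MumfordQuartic.A₂_pow_five (Q := Q) c) (Q.orbitClass_rational _) (Q.orbitClass_rational _)
    (MumfordQuartic.four_le_finrank_V hΔ) hL₁ hL₂ h
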